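/- Let $T, L > 0$. Then there exist $\delta > 0$ and $C > 0$, depending only on $T$ and $L$, such that for every $\alpha > 0$ and every $y_0 \in C^1([0,L])$ with $\|y_0\|_{C^1([0,L])} \le \delta$ there exist controls $p^\alpha \in C^0([0,T])$ with $p^\alpha(T) = 0$ and $v_l^\alpha, v_r^\alpha \in C^1([0,T])$, and an associated state $(y^\alpha, z^\alpha) \in C^1([0,T]\times[0,L];\mathbb{R}^2)$, satisfying the inviscid Burgers-$\alpha$ system $$ \begin{cases} y_t + z\,y_x = p(t) & \text{in } (0,T)\times(0,L),\\ z - \alpha^2 z_{xx} = y & \text{in } (0,T)\times(0,L),\\ z(\cdot,0) = y(\cdot,0) = v_l & \text{in } (0,T),\\ z(\cdot,L) = y(\cdot,L) = v_r & \text{in } (0,T),\\ y(0,\cdot) = y_0 & \text{in } (0,L) \end{cases} $$ in the classical sense (in particular $z^\alpha(t,\cdot)$ is $C^2$ in $(0,L)$ for each $t \in (0,T)$), such that $$ y^\alpha(T,\cdot) = z^\alpha(T,\cdot) = 0 \quad \text{in } (0,L) $$ and $$ \|p^\alpha\|_{C^0([0,T])} + \|(v_l^\alpha, v_r^\alpha)\|_{C^1([0,T];\mathbb{R}^2)}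 \le C . $$ Here $\|f\|_{C^0(K)} = \sup_K |f|$ and $\|f\|_{C^1(K)} = \sup_K |f| + \sup_K |f'|$, where $|\cdot|$ is the Euclidean norm on $\mathbb{R}^2$ for the pair of boundary controls. -/

import Mathlib

open Set

noncomputable section

namespace BurgersAlpha

/-- The norm `sup_{s ∈ K} ‖f s‖` of `C⁰(K; E)`, for a compact `K` and `f` continuous on `K`
(the supremum is then that of a bounded set). -/
def c0Norm {E : Type*} [NormedAddCommGroup E] (K : Set ℝ) (f : ℝ → E) : ℝ :=
  sSup ((fun s => ‖f s‖) '' K)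

/-- The norm `sup_K ‖f‖ + sup_K ‖f'‖` of `C¹(K; E)`, for a compact interval `K`;
the derivative is one-sided at the end points. -/
def c1Norm {E : Type*} [NormedAddCommGroup E] [NormedSpace ℝ E] (K : Set ℝ) (f : ℝ → E) : ℝ :=
  c0Norm K f + c0Norm K (derivWithin f K)

/-- `(y, z) ∈ C¹([0,T] × [0,L]; ℝ²)` is a classical solution of the inviscid Burgers-α system
with distributed control `p`, boundary controls `vl`, `vr` and initial datum `y₀`.
Functions of `(t, x)` are written `y t x`. -/
structure IsSolution (T L α : ℝ) (y₀ : ℝ → ℝ) (p vl vr : ℝ → ℝ) (y z : ℝ → ℝ → ℝ) : Prop where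
  contDiffOn_y : ContDiffOn ℝ 1 (fun q : ℝ × ℝ => y q.1 q.2) (Icc 0 T ×ˢ Icc 0 L)
  contDiffOn_z : ContDiffOn ℝ 1 (fun q : ℝ × ℝ => z q.1 q.2) (Icc 0 T ×ˢ Icc 0 L)
  /-- `y_t + z y_x = p(t)` in `(0,T) × (0,L)` -/
  transport : ∀ t ∈ Ioo 0 T, ∀ x ∈ Ioo 0 L,
    deriv (fun s => y s x) t + z t x * deriv (fun ξ => y t ξ) x = p t
  /-- `z(t,·)` is twice continuously differentiable in `(0,L)`, so that `z_xx` is a classical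
  derivative -/
  contDiffOn_z_space : ∀ t ∈ Ioo 0 T, ContDiffOn ℝ 2 (z t) (Ioo 0 L)
  /-- `z - α² z_xx = y` in `(0,T) × (0,L)` -/
  filter : ∀ t ∈ Ioo 0 T, ∀ x ∈ Ioo 0 L,
    z t x - α ^ 2 * deriv (deriv (z t)) x = y t x
  /-- `z(·,0) = y(·,0) = v_l` in `(0,T)` -/
  left : ∀ t ∈ Ioo 0 T, z t 0 = vl t ∧ y t 0 = vl t
  /-- `z(·,L) = y(·,L) = v_r` in `(0,T)` -/
  right : ∀ t ∈ Ioo 0 T, z t L = vr t ∧ y t L = vr t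
  /-- `y(0,·) = y₀` in `(0,L)` -/
  initial : ∀ x ∈ Ioo 0 L, y 0 x = y₀ x

end BurgersAlpha

end

/-! The argument is the return method. Choose `ℓ` with `ℓ 0 = ℓ T = 0` and `ℓ' T = 0`, and look for
`y = ℓ + u`, `z = ℓ + w`, `p = ℓ'`. Constants are fixed by the filter, so `w - α² w'' = u` with `w =
u` at `0` and `L`, and the system becomes `u_t + (ℓ + w) u_x = 0`. The boundary controls are simply
the traces of `y`. The datum is extended to a function on `ℝ` that vanishes on `(-∞, -1]`. The
displacement `∫ ℓ = L + 1 + T` is so large that every particle found at some `x ≤ L` at time `T`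
started in `(-∞, -1]`. Hence `u`, and with it `w`, vanishes on `[0, L]` at time `T`.

For fixed `α` the coupled transport problem is solved on the whole line by a contraction in an
exponentially weighted norm (`exists_selfconsistent_flow`). The constants used there depend on `α`,
but they serve existence only.

Uniformity in `α` comes from the maximum principle `abs_filterDer_le`. The function `w'` solves a
Neumann problem with right-hand side `u'`, because `w'' = (w - u) / α²` vanishes at both end points,
so `sup |w'| ≤ sup |u'|`. Along characteristics `|u_x|` grows at most like `exp (∫ sup |w'|)`; the
two facts give a closed Riccati-type inequality, and small data keep `|u_x|` bounded on all of `[0,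
T]` (`exists_transported_density`). Time derivatives of the boundary traces are then read off the
transport equation. -/

open Filter Topology

namespace BurgersAlpha

/-! ### Calculus in two real variables -/

section Calculus

/-- A function of two real variables with continuous partial derivatives is `C¹`. -/
theorem hasStrictFDerivAt_of_partials {f f₁ f₂ : ℝ → ℝ → ℝ}
    (h₁ : ∀ t x, HasDerivAt (fun s => f s x) (f₁ t x) t)
    (h₂ : ∀ t x, HasDerivAt (f t) (f₂ t x) x)
    (c₁ : Continuous fun q : ℝ × ℝ => f₁ q.1 q.2) (c₂ : Continuous fun q : ℝ × ℝ => f₂ q.1 q.2)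
    (q : ℝ × ℝ) :
    HasStrictFDerivAt (fun q : ℝ × ℝ => f q.1 q.2)
      ((ContinuousLinearMap.toSpanSingleton ℝ (f₁ q.1 q.2)).coprod
        (ContinuousLinearMap.toSpanSingleton ℝ (f₂ q.1 q.2))) q := by
  have key := hasStrictFDerivAt_uncurry_coprod (𝕜 := ℝ) (u := q) (f := f)
    (f₁ := fun t x => ContinuousLinearMap.toSpanSingleton ℝ (f₁ t x))
    (f₂ := fun t x => ContinuousLinearMap.toSpanSingleton ℝ (f₂ t x))
    (Eventually.of_forall fun v => (h₁ v.1 v.2).hasFDerivAt)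
    (Eventually.of_forall fun v => (h₂ v.1 v.2).hasFDerivAt)
    ((ContinuousLinearMap.toSpanSingletonCLE (𝕜 := ℝ) (E := ℝ)).continuous.comp c₁).continuousAt
    ((ContinuousLinearMap.toSpanSingletonCLE (𝕜 := ℝ) (E := ℝ)).continuous.comp c₂).continuousAt
  exact key

theorem contDiff_one_of_partials {f f₁ f₂ : ℝ → ℝ → ℝ}
    (h₁ : ∀ t x, HasDerivAt (fun s => f s x) (f₁ t x) t)
    (h₂ : ∀ t x, HasDerivAt (f t) (f₂ t x) x)
    (c₁ : Continuous fun q : ℝ × ℝ => f₁ q.1 q.2) (c₂ : Continuous fun q : ℝ × ℝ => f₂ q.1 q.2) :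
    ContDiff ℝ 1 (fun q : ℝ × ℝ => f q.1 q.2) := by
  rw [contDiff_one_iff_hasFDerivAt]
  refine ⟨_, ?_, fun q => (hasStrictFDerivAt_of_partials h₁ h₂ c₁ c₂ q).hasFDerivAt⟩
  have e₁ := (ContinuousLinearMap.toSpanSingletonCLE (𝕜 := ℝ) (E := ℝ)).continuous.comp c₁
  have e₂ := (ContinuousLinearMap.toSpanSingletonCLE (𝕜 := ℝ) (E := ℝ)).continuous.comp c₂
  have : Continuous fun q : ℝ × ℝ =>
      (ContinuousLinearMap.toSpanSingleton ℝ (f₁ q.1 q.2)).comp (ContinuousLinearMap.fst ℝ ℝ ℝ) +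
      (ContinuousLinearMap.toSpanSingleton ℝ (f₂ q.1 q.2)).comp (ContinuousLinearMap.snd ℝ ℝ ℝ) :=
    (e₁.clm_comp continuous_const).add (e₂.clm_comp continuous_const)
  exact this.congr fun q => by ext <;> simp

/-- The partial derivatives of a `C¹` function of two real variables. -/
theorem exists_partials {f : ℝ → ℝ → ℝ} (hf : ContDiff ℝ 1 (fun q : ℝ × ℝ => f q.1 q.2)) :
    ∃ f₁ f₂ : ℝ → ℝ → ℝ, (∀ t x, HasDerivAt (fun s => f s x) (f₁ t x) t) ∧
      (∀ t x, HasDerivAt (f t) (f₂ t x) x) ∧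
      (Continuous fun q : ℝ × ℝ => f₁ q.1 q.2) ∧ (Continuous fun q : ℝ × ℝ => f₂ q.1 q.2) ∧
      ∀ t x, HasFDerivAt (fun q : ℝ × ℝ => f q.1 q.2)
        ((ContinuousLinearMap.toSpanSingleton ℝ (f₁ t x)).coprod
        (ContinuousLinearMap.toSpanSingleton ℝ (f₂ t x))) (t, x) := by
  set F : ℝ × ℝ → ℝ := fun q => f q.1 q.2 with hF
  have hc : Continuous (fderiv ℝ F) := hf.continuous_fderiv one_ne_zero
  have hd : ∀ q, HasFDerivAt F (fderiv ℝ F q) q := fun q =>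
    (hf.differentiable one_ne_zero q).hasFDerivAt
  refine ⟨fun t x => fderiv ℝ F (t, x) (1, 0), fun t x => fderiv ℝ F (t, x) (0, 1), ?_, ?_,
    hc.clm_apply continuous_const, hc.clm_apply continuous_const, ?_⟩
  · intro t x
    exact (hd (t, x)).comp_hasDerivAt t ((hasDerivAt_id t).prodMk (hasDerivAt_const t x))
  · intro t x
    exact (hd (t, x)).comp_hasDerivAt x ((hasDerivAt_const x t).prodMk (hasDerivAt_id x))
  · intro t x
    convert hd (t, x) using 1
    ext <;> simp

/-- Differentiation under the integral sign. -/
theorem hasDerivAt_intervalIntegral {F F' : ℝ → ℝ → ℝ}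
    (h : ∀ t x, HasDerivAt (fun s => F s x) (F' t x) t)
    (c : Continuous fun q : ℝ × ℝ => F q.1 q.2) (c' : Continuous fun q : ℝ × ℝ => F' q.1 q.2)
    (a b t : ℝ) :
    HasDerivAt (fun s => ∫ x in a..b, F s x) (∫ x in a..b, F' t x) t := by
  have hK : IsCompact (Metric.closedBall t 1 ×ˢ uIcc a b) :=
    (isCompact_closedBall t 1).prod isCompact_uIcc
  obtain ⟨C, hC⟩ := hK.exists_bound_of_continuousOn c'.continuousOn
  have e : ∀ s, Continuous (F s) := fun s => c.comp (by fun_prop : Continuous fun x => (s, x))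
  have e' : ∀ s, Continuous (F' s) := fun s => c'.comp (by fun_prop : Continuous fun x => (s, x))
  refine (intervalIntegral.hasDerivAt_integral_of_dominated_loc_of_deriv_le
    (bound := fun _ => C) (Metric.closedBall_mem_nhds t one_pos)
    (Eventually.of_forall fun s => (e s).aestronglyMeasurable)
    ((e t).intervalIntegrable _ _) (e' t).aestronglyMeasurable
    (Eventually.of_forall fun x hx s hs => hC (s, x) ⟨hs, uIoc_subset_uIcc hx⟩)
    intervalIntegrable_const (Eventually.of_forall fun x _ s _ => h s x)).2

end Calculus

/-! ### The filter equation: explicit solution of the Dirichlet problem -/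

section Elliptic

/-- `∫₀ˣ cosh (s/α) u s ds` -/
noncomputable def coshInt (α : ℝ) (u : ℝ → ℝ) (x : ℝ) : ℝ := ∫ s in (0 : ℝ)..x, Real.cosh (s / α) * u s

/-- `∫₀ˣ sinh (s/α) u s ds` -/
noncomputable def sinhInt (α : ℝ) (u : ℝ → ℝ) (x : ℝ) : ℝ := ∫ s in (0 : ℝ)..x, Real.sinh (s / α) * u s

/-- The solution of `w - α² w'' = u` with `w 0 = w' 0 = 0`. -/
noncomputable def duhamel (α : ℝ) (u : ℝ → ℝ) (x : ℝ) : ℝ :=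
  -(1 / α) * (Real.sinh (x / α) * coshInt α u x - Real.cosh (x / α) * sinhInt α u x)

/-- The coefficient of `sinh (x/α)` in the solution of the Dirichlet problem. -/
noncomputable def sinhCoeff (α L : ℝ) (u : ℝ → ℝ) : ℝ :=
  (u L - u 0 * Real.cosh (L / α) - duhamel α u L) / Real.sinh (L / α)

/-- The solution `w` of `w - α² w'' = u` with `w = u` at `0` and `L`. -/
noncomputable def filterSol (α L : ℝ) (u : ℝ → ℝ) (x : ℝ) : ℝ :=
  duhamel α u x + u 0 * Real.cosh (x / α) + sinhCoeff α L u * Real.sinh (x / α)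

/-- The derivative of `filterSol α L u`. -/
noncomputable def filterDer (α L : ℝ) (u : ℝ → ℝ) (x : ℝ) : ℝ :=
  -(1 / α ^ 2) * (Real.cosh (x / α) * coshInt α u x - Real.sinh (x / α) * sinhInt α u x) +
    u 0 / α * Real.sinh (x / α) + sinhCoeff α L u / α * Real.cosh (x / α)

variable {α L : ℝ} {u v : ℝ → ℝ}

theorem hasDerivAt_coshInt (α : ℝ) (hu : Continuous u) (x : ℝ) :
    HasDerivAt (coshInt α u) (Real.cosh (x / α) * u x) x :=
  (by fun_prop : Continuous fun s => Real.cosh (s / α) * u s).integral_hasStrictDerivAt 0 x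
    |>.hasDerivAt

theorem hasDerivAt_sinhInt (α : ℝ) (hu : Continuous u) (x : ℝ) :
    HasDerivAt (sinhInt α u) (Real.sinh (x / α) * u x) x :=
  (by fun_prop : Continuous fun s => Real.sinh (s / α) * u s).integral_hasStrictDerivAt 0 x
    |>.hasDerivAt

theorem hasDerivAt_cosh_div (α x : ℝ) :
    HasDerivAt (fun x => Real.cosh (x / α)) (Real.sinh (x / α) / α) x := by
  simpa [div_eq_mul_inv] using ((hasDerivAt_id x).div_const α).cosh

theorem hasDerivAt_sinh_div (α x : ℝ) :
    HasDerivAt (fun x => Real.sinh (x / α)) (Real.cosh (x / α) / α) x := by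
  simpa [div_eq_mul_inv] using ((hasDerivAt_id x).div_const α).sinh

theorem hasDerivAt_filterSol (α L : ℝ) (hu : Continuous u) (x : ℝ) :
    HasDerivAt (filterSol α L u) (filterDer α L u x) x := by
  have hc := hasDerivAt_cosh_div α x
  have hs := hasDerivAt_sinh_div α x
  have h := ((((hs.mul (hasDerivAt_coshInt α hu x)).sub
    (hc.mul (hasDerivAt_sinhInt α hu x))).const_mul (-(1 / α))).add (hc.const_mul (u 0))).add
    (hs.const_mul (sinhCoeff α L u))
  refine h.congr_deriv ?_
  unfold filterDer
  ring

/-- This is the filter equation itself. Differentiating the two primitives leaves the extra term `-u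
(cosh² - sinh²) / α²`. In this form the second derivative visibly vanishes wherever `w = u`, in
particular at both end points. -/
theorem hasDerivAt_filterDer (hα : α ≠ 0) (L : ℝ) (hu : Continuous u) (x : ℝ) :
    HasDerivAt (filterDer α L u) ((filterSol α L u x - u x) / α ^ 2) x := by
  have hc := hasDerivAt_cosh_div α x
  have hs := hasDerivAt_sinh_div α x
  have h := ((((hc.mul (hasDerivAt_coshInt α hu x)).sub
    (hs.mul (hasDerivAt_sinhInt α hu x))).const_mul (-(1 / α ^ 2))).add
    (hs.const_mul (u 0 / α))).add (hc.const_mul (sinhCoeff α L u / α))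
  refine h.congr_deriv ?_
  unfold filterSol duhamel
  have := Real.cosh_sq (x / α)
  field_simp
  linear_combination (-u x * α) * this

theorem filterSol_zero (α L : ℝ) (u : ℝ → ℝ) : filterSol α L u 0 = u 0 := by
  simp [filterSol, duhamel, coshInt, sinhInt]

theorem filterSol_right (hα : 0 < α) (hL : 0 < L) (u : ℝ → ℝ) : filterSol α L u L = u L := by
  have : Real.sinh (L / α) ≠ 0 := (Real.sinh_pos_iff.2 (div_pos hL hα)).ne'
  simp only [filterSol, sinhCoeff]
  field_simp
  ring

theorem coshInt_sub (α : ℝ) (hu : Continuous u) (hv : Continuous v) (x : ℝ) :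
    coshInt α (fun s => u s - v s) x = coshInt α u x - coshInt α v x := by
  unfold coshInt
  rw [← intervalIntegral.integral_sub] <;>
    first
    | (congr 1; ext s; ring)
    | exact (by fun_prop : Continuous _).intervalIntegrable _ _

theorem sinhInt_sub (α : ℝ) (hu : Continuous u) (hv : Continuous v) (x : ℝ) :
    sinhInt α (fun s => u s - v s) x = sinhInt α u x - sinhInt α v x := by
  unfold sinhInt
  rw [← intervalIntegral.integral_sub] <;>
    first
    | (congr 1; ext s; ring)
    | exact (by fun_prop : Continuous _).intervalIntegrable _ _

theorem filterSol_sub (α L : ℝ) (hu : Continuous u) (hv : Continuous v) (x : ℝ) :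
    filterSol α L (fun s => u s - v s) x = filterSol α L u x - filterSol α L v x := by
  simp only [filterSol, sinhCoeff, duhamel, coshInt_sub α hu hv, sinhInt_sub α hu hv]
  ring

theorem filterDer_sub (α L : ℝ) (hu : Continuous u) (hv : Continuous v) (x : ℝ) :
    filterDer α L (fun s => u s - v s) x = filterDer α L u x - filterDer α L v x := by
  simp only [filterDer, sinhCoeff, duhamel, coshInt_sub α hu hv, sinhInt_sub α hu hv]
  ring

theorem coshInt_congr (α : ℝ) (h : ∀ x ∈ Icc 0 L, u x = v x) {x : ℝ} (hx : x ∈ Icc 0 L) :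
    coshInt α u x = coshInt α v x :=
  intervalIntegral.integral_congr fun s hs => by
    rw [uIcc_of_le hx.1] at hs
    simp only [h s ⟨hs.1, hs.2.trans hx.2⟩]

theorem sinhInt_congr (α : ℝ) (h : ∀ x ∈ Icc 0 L, u x = v x) {x : ℝ} (hx : x ∈ Icc 0 L) :
    sinhInt α u x = sinhInt α v x :=
  intervalIntegral.integral_congr fun s hs => by
    rw [uIcc_of_le hx.1] at hs
    simp only [h s ⟨hs.1, hs.2.trans hx.2⟩]

/-- Needed at time `T`, when the density vanishes to the left of `L` but possibly not on the whole
line. -/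
theorem filterSol_congr (α : ℝ) (hL : 0 ≤ L) (h : ∀ x ∈ Icc 0 L, u x = v x) {x : ℝ}
    (hx : x ∈ Icc 0 L) : filterSol α L u x = filterSol α L v x := by
  have h0 := h 0 ⟨le_rfl, hL⟩
  have h1 := h L ⟨hL, le_rfl⟩
  have hLL : L ∈ Icc 0 L := ⟨hL, le_rfl⟩
  simp only [filterSol, sinhCoeff, duhamel, coshInt_congr α h hx, sinhInt_congr α h hx,
    coshInt_congr α h hLL, sinhInt_congr α h hLL, h0, h1]

theorem filterSol_const_zero (α L x : ℝ) : filterSol α L (fun _ => 0) x = 0 := by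
  simp [filterSol, sinhCoeff, duhamel, coshInt, sinhInt]

theorem filterDer_const_zero (α L x : ℝ) : filterDer α L (fun _ => 0) x = 0 := by
  simp [filterDer, sinhCoeff, duhamel, coshInt, sinhInt]

/-! ### Filter bounds with constants depending on `α` -/

section Bounds

theorem abs_cosh_div_le (hα : 0 < α) {x : ℝ} (hx : x ∈ Icc 0 L) :
    |Real.cosh (x / α)| ≤ Real.cosh (L / α) := by
  rw [abs_of_pos (Real.cosh_pos _), Real.cosh_le_cosh, abs_of_nonneg (div_nonneg hx.1 hα.le),
    abs_of_nonneg (div_nonneg (hx.1.trans hx.2) hα.le)]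
  exact div_le_div_of_nonneg_right hx.2 hα.le

theorem abs_sinh_div_le (hα : 0 < α) {x : ℝ} (hx : x ∈ Icc 0 L) :
    |Real.sinh (x / α)| ≤ Real.cosh (L / α) := by
  refine le_trans ?_ (abs_cosh_div_le hα hx)
  rw [abs_of_nonneg (Real.sinh_nonneg_iff.2 (div_nonneg hx.1 hα.le)), abs_of_pos (Real.cosh_pos _)]
  exact (Real.sinh_lt_cosh _).le

theorem abs_integral_mul_le {k : ℝ → ℝ} {M A : ℝ} (hM : ∀ x ∈ Icc 0 L, |k x| ≤ M)
    (hA : ∀ x ∈ Icc 0 L, |u x| ≤ A) {x : ℝ} (hx : x ∈ Icc 0 L) :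
    |∫ s in (0 : ℝ)..x, k s * u s| ≤ M * L * A := by
  have hM0 : 0 ≤ M := (abs_nonneg _).trans (hM x hx)
  have hA0 : 0 ≤ A := (abs_nonneg _).trans (hA x hx)
  have h : ∀ s ∈ uIoc 0 x, ‖k s * u s‖ ≤ M * A := by
    intro s hs
    rw [uIoc_of_le hx.1] at hs
    have hs' : s ∈ Icc 0 L := ⟨hs.1.le, hs.2.trans hx.2⟩
    rw [Real.norm_eq_abs, abs_mul]
    exact mul_le_mul (hM s hs') (hA s hs') (abs_nonneg _) hM0
  have := intervalIntegral.norm_integral_le_of_norm_le_const h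
  rw [Real.norm_eq_abs, sub_zero, abs_of_nonneg hx.1] at this
  nlinarith [mul_le_mul_of_nonneg_left hx.2 (mul_nonneg hM0 hA0)]

/-- For fixed `α` both `w` and `w'` are controlled by the sup norm of `u`. -/
theorem exists_filter_bound (hα : 0 < α) (hL : 0 < L) :
    ∃ C : ℝ, 0 < C ∧ ∀ u : ℝ → ℝ, ∀ A : ℝ, (∀ x ∈ Icc 0 L, |u x| ≤ A) →
      ∀ x ∈ Icc 0 L, |filterSol α L u x| ≤ C * A ∧ |filterDer α L u x| ≤ C * A := by
  set h := Real.cosh (L / α) with hh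
  set S := Real.sinh (L / α) with hS
  have hpos : 0 < h := Real.cosh_pos _
  have hSpos : 0 < S := Real.sinh_pos_iff.2 (div_pos hL hα)
  set D := 1 / α * (h * (h * L) + h * (h * L)) with hD
  set B := (1 + h + D) / S with hB
  have hD0 : 0 < D := by positivity
  have hB0 : 0 < B := by positivity
  set C₁ := D + h + B * h with hC₁
  set C₂ := 1 / α ^ 2 * (h * (h * L) + h * (h * L)) + 1 / α * h + B / α * h with hC₂
  have hC₁0 : 0 < C₁ := by positivity
  have hC₂0 : 0 < C₂ := by positivity
  refine ⟨C₁ + C₂, by positivity, fun u A hA x hx => ?_⟩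
  have hA0 : 0 ≤ A := (abs_nonneg _).trans (hA x hx)
  have h0 : (0 : ℝ) ∈ Icc 0 L := ⟨le_rfl, hL.le⟩
  have hLL : L ∈ Icc 0 L := ⟨hL.le, le_rfl⟩
  have kc : ∀ x ∈ Icc 0 L, |Real.cosh (x / α)| ≤ h := fun x hx => abs_cosh_div_le hα hx
  have ks : ∀ x ∈ Icc 0 L, |Real.sinh (x / α)| ≤ h := fun x hx => abs_sinh_div_le hα hx
  have ic : ∀ x ∈ Icc 0 L, |coshInt α u x| ≤ h * L * A := fun x hx => abs_integral_mul_le kc hA hx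
  have is : ∀ x ∈ Icc 0 L, |sinhInt α u x| ≤ h * L * A := fun x hx => abs_integral_mul_le ks hA hx
  have mulb : ∀ {p q P Q : ℝ}, |p| ≤ P → |q| ≤ Q → |p * q| ≤ P * Q := fun hp hq => by
    rw [abs_mul]; exact mul_le_mul hp hq (abs_nonneg _) ((abs_nonneg _).trans hp)
  have addb : ∀ {p q P Q : ℝ}, |p| ≤ P → |q| ≤ Q → |p + q| ≤ P + Q := fun hp hq =>
    (abs_add_le _ _).trans (add_le_add hp hq)
  have subb : ∀ {p q P Q : ℝ}, |p| ≤ P → |q| ≤ Q → |p - q| ≤ P + Q := fun hp hq =>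
    (abs_sub _ _).trans (add_le_add hp hq)
  have hia : |-(1 / α)| ≤ 1 / α := by rw [abs_neg, abs_of_pos (by positivity)]
  have hia2 : |-(1 / α ^ 2)| ≤ 1 / α ^ 2 := by rw [abs_neg, abs_of_pos (by positivity)]
  have dub : ∀ x ∈ Icc 0 L, |duhamel α u x| ≤ D * A := fun x hx => by
    refine (mulb hia (subb (mulb (ks x hx) (ic x hx)) (mulb (kc x hx) (is x hx)))).trans_eq ?_
    rw [hD]; ring
  have cb : |sinhCoeff α L u| ≤ B * A := by
    unfold sinhCoeff
    rw [abs_div, ← hS, abs_of_pos hSpos, hB, div_mul_eq_mul_div]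
    refine div_le_div_of_nonneg_right ?_ hSpos.le
    refine (subb (subb (hA L hLL) (mulb (hA 0 h0) (kc L hLL))) (dub L hLL)).trans_eq ?_
    ring
  have diva : ∀ {p P : ℝ}, |p| ≤ P → |p / α| ≤ P / α := fun hp => by
    rw [abs_div, abs_of_pos hα]; exact div_le_div_of_nonneg_right hp hα.le
  constructor
  · refine (addb (addb (dub x hx) (mulb (hA 0 h0) (kc x hx))) (mulb cb (ks x hx))).trans ?_
    have : D * A + A * h + B * A * h = C₁ * A := by rw [hC₁]; ring
    rw [this]
    exact mul_le_mul_of_nonneg_right (by linarith) hA0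
  · refine (addb (addb (mulb hia2 (subb (mulb (kc x hx) (ic x hx)) (mulb (ks x hx) (is x hx))))
      (mulb (diva (hA 0 h0)) (ks x hx))) (mulb (diva cb) (kc x hx))).trans ?_
    refine le_trans (b := C₂ * A) (le_of_eq ?_) (mul_le_mul_of_nonneg_right (by linarith) hA0)
    rw [hC₂]; ring

end Bounds

/-! ### Regularity of the filtered function in time and space -/

section TimeDependence

variable {U U' : ℝ → ℝ → ℝ}

theorem continuous_coshInt (α : ℝ) (c : Continuous fun q : ℝ × ℝ => U q.1 q.2) :
    Continuous fun q : ℝ × ℝ => coshInt α (U q.1) q.2 :=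
  intervalIntegral.continuous_parametric_primitive_of_continuous
    (f := fun t s => Real.cosh (s / α) * U t s)
    ((by fun_prop : Continuous fun q : ℝ × ℝ => Real.cosh (q.2 / α)).mul c)

theorem continuous_sinhInt (α : ℝ) (c : Continuous fun q : ℝ × ℝ => U q.1 q.2) :
    Continuous fun q : ℝ × ℝ => sinhInt α (U q.1) q.2 :=
  intervalIntegral.continuous_parametric_primitive_of_continuous
    (f := fun t s => Real.sinh (s / α) * U t s)
    ((by fun_prop : Continuous fun q : ℝ × ℝ => Real.sinh (q.2 / α)).mul c)

theorem continuous_duhamel (α : ℝ) (c : Continuous fun q : ℝ × ℝ => U q.1 q.2) :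
    Continuous fun q : ℝ × ℝ => duhamel α (U q.1) q.2 := by
  have h₁ := continuous_coshInt α c
  have h₂ := continuous_sinhInt α c
  unfold duhamel
  fun_prop

theorem continuous_sinhCoeff (α L : ℝ) (c : Continuous fun q : ℝ × ℝ => U q.1 q.2) :
    Continuous fun t => sinhCoeff α L (U t) := by
  have h₁ : Continuous fun t : ℝ => duhamel α (U t) L :=
    (continuous_duhamel α c).comp (by fun_prop : Continuous fun t : ℝ => (t, L))
  have h₂ : ∀ x, Continuous fun t : ℝ => U t x := fun x =>
    c.comp (by fun_prop : Continuous fun t : ℝ => (t, x))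
  exact (((h₂ L).sub ((h₂ 0).mul continuous_const)).sub h₁).div_const _

theorem continuous_filterSol (α L : ℝ) (c : Continuous fun q : ℝ × ℝ => U q.1 q.2) :
    Continuous fun q : ℝ × ℝ => filterSol α L (U q.1) q.2 := by
  have h₁ := continuous_duhamel α c
  have h₂ := (continuous_sinhCoeff α L c).comp (continuous_fst (X := ℝ) (Y := ℝ))
  have h₃ : Continuous fun q : ℝ × ℝ => U q.1 0 :=
    c.comp (by fun_prop : Continuous fun q : ℝ × ℝ => (q.1, (0 : ℝ)))
  exact (h₁.add (h₃.mul (by fun_prop))).add (h₂.mul (by fun_prop))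

theorem continuous_filterDer (α L : ℝ) (c : Continuous fun q : ℝ × ℝ => U q.1 q.2) :
    Continuous fun q : ℝ × ℝ => filterDer α L (U q.1) q.2 := by
  have h₀ := continuous_coshInt α c
  have h₁ := continuous_sinhInt α c
  have h₂ := (continuous_sinhCoeff α L c).comp (continuous_fst (X := ℝ) (Y := ℝ))
  have h₃ : Continuous fun q : ℝ × ℝ => U q.1 0 :=
    c.comp (by fun_prop : Continuous fun q : ℝ × ℝ => (q.1, (0 : ℝ)))
  have h₄ : Continuous fun q : ℝ × ℝ => Real.cosh (q.2 / α) := by fun_prop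
  have h₅ : Continuous fun q : ℝ × ℝ => Real.sinh (q.2 / α) := by fun_prop
  exact ((continuous_const.mul ((h₄.mul h₀).sub (h₅.mul h₁))).add
    ((h₃.div_const _).mul h₅)).add ((h₂.div_const _).mul h₄)

/-- The solution operator is linear with kernels independent of time, so it commutes with the time
derivative. -/
theorem hasDerivAt_filterSol_time (α L : ℝ) (h : ∀ t x, HasDerivAt (fun s => U s x) (U' t x) t)
    (c : Continuous fun q : ℝ × ℝ => U q.1 q.2) (c' : Continuous fun q : ℝ × ℝ => U' q.1 q.2)
    (t x : ℝ) :
    HasDerivAt (fun s => filterSol α L (U s) x) (filterSol α L (U' t) x) t := by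
  have hc : ∀ x, HasDerivAt (fun s => coshInt α (U s) x) (coshInt α (U' t) x) t := fun x =>
    hasDerivAt_intervalIntegral (fun t x => (h t x).const_mul (Real.cosh (x / α)))
      ((by fun_prop : Continuous fun q : ℝ × ℝ => Real.cosh (q.2 / α)).mul c)
      ((by fun_prop : Continuous fun q : ℝ × ℝ => Real.cosh (q.2 / α)).mul c') 0 x t
  have hs : ∀ x, HasDerivAt (fun s => sinhInt α (U s) x) (sinhInt α (U' t) x) t := fun x =>
    hasDerivAt_intervalIntegral (fun t x => (h t x).const_mul (Real.sinh (x / α)))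
      ((by fun_prop : Continuous fun q : ℝ × ℝ => Real.sinh (q.2 / α)).mul c)
      ((by fun_prop : Continuous fun q : ℝ × ℝ => Real.sinh (q.2 / α)).mul c') 0 x t
  have hd : ∀ x, HasDerivAt (fun s => duhamel α (U s) x) (duhamel α (U' t) x) t := fun x =>
    (((hc x).const_mul _).sub ((hs x).const_mul _)).const_mul _
  have hb : HasDerivAt (fun s => sinhCoeff α L (U s)) (sinhCoeff α L (U' t)) t :=
    (((h t L).sub ((h t 0).mul_const _)).sub (hd L)).div_const _
  exact ((hd x).add ((h t 0).mul_const _)).add (hb.mul_const _)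

theorem contDiff_filterSol (α L : ℝ) (hU : ContDiff ℝ 1 fun q : ℝ × ℝ => U q.1 q.2) :
    ContDiff ℝ 1 fun q : ℝ × ℝ => filterSol α L (U q.1) q.2 := by
  obtain ⟨U₁, -, h, -, c₁, -, -⟩ := exists_partials hU
  have c := hU.continuous
  exact contDiff_one_of_partials (f := fun t => filterSol α L (U t))
    (hasDerivAt_filterSol_time α L h c c₁)
    (fun t x => hasDerivAt_filterSol α L
      (c.comp (by fun_prop : Continuous fun x : ℝ => (t, x))) x)
    (continuous_filterSol α L c₁) (continuous_filterDer α L c)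

end TimeDependence

/-! ### Maximum principle for `w'`, uniform in `α` -/

section MaximumPrinciple

/-- One half of the maximum principle for the Neumann problem solved by `w'`. -/
theorem filterDer_le (hα : 0 < α) (hL : 0 < L) {u' : ℝ → ℝ} (hu : ∀ x, HasDerivAt u (u' x) x)
    {m : ℝ} (hm : ∀ x ∈ Icc 0 L, u' x ≤ m) : ∀ x ∈ Icc 0 L, filterDer α L u x ≤ m := by
  have hc : Continuous u := continuous_iff_continuousAt.2 fun x => (hu x).continuousAt
  set g := filterDer α L u with hg
  set h : ℝ → ℝ := fun x => (filterSol α L u x - u x) / α ^ 2 with hh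
  have dg : ∀ x, HasDerivAt g (h x) x := hasDerivAt_filterDer hα.ne' L hc
  have dh : ∀ x, HasDerivAt h ((g x - u' x) / α ^ 2) x := fun x =>
    ((hasDerivAt_filterSol α L hc x).sub (hu x)).div_const _
  have cg : Continuous g := continuous_iff_continuousAt.2 fun x => (dg x).continuousAt
  obtain ⟨x₀, hx₀, hmax⟩ := isCompact_Icc.exists_isMaxOn (nonempty_Icc.2 hL.le) cg.continuousOn
  intro x hx
  refine (hmax hx).trans ?_
  by_contra! hlt
  -- The derivative `h` of `g` vanishes at the maximum point even if this is an end point, where the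
  -- Dirichlet condition `w = u` acts as a Neumann condition on `g`.
  have hz : h x₀ = 0 := by
    rcases eq_or_lt_of_le hx₀.1 with h0 | h0
    · simp only [hh, ← h0, filterSol_zero, sub_self, zero_div]
    rcases eq_or_lt_of_le hx₀.2 with h1 | h1
    · simp only [hh, h1, filterSol_right hα hL, sub_self, zero_div]
    · exact (hmax.isLocalMax (Icc_mem_nhds h0 h1)).hasDerivAt_eq_zero (dg x₀)
  -- If the bound failed, `h` would increase through zero at `x₀`, so `g` would strictly increase
  -- when moving away from `x₀` to either side; whichever side remains in `[0, L]` contradicts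
  -- maximality.
  have hpos : 0 < (g x₀ - u' x₀) / α ^ 2 :=
    div_pos (by linarith [hm x₀ hx₀]) (by positivity)
  have hev : ∀ᶠ y in 𝓝[≠] x₀, 0 < slope h x₀ y :=
    (hasDerivAt_iff_tendsto_slope.1 (dh x₀)).eventually (lt_mem_nhds hpos)
  rw [eventually_nhdsWithin_iff, Metric.eventually_nhds_iff] at hev
  obtain ⟨ε, hε, hball⟩ := hev
  have sgn : ∀ y, |y - x₀| < ε → y ≠ x₀ → 0 < h y / (y - x₀) := fun y hy hne => by
    have := hball (y := y) (by rwa [Real.dist_eq]) hne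
    rwa [slope_def_field, hz, sub_zero] at this
  rcases lt_or_ge x₀ L with hlt' | hge
  · obtain ⟨y, hy₁, hy₂⟩ : ∃ y, x₀ < y ∧ y < min (x₀ + ε) L :=
      exists_between (lt_min (by linarith) hlt')
    have hyε := hy₂.trans_le (min_le_left _ _)
    have hyL := hy₂.trans_le (min_le_right _ _)
    obtain ⟨c, hc, hcd⟩ := exists_hasDerivAt_eq_slope g h hy₁ cg.continuousOn (fun x _ => dg x)
    have h1 := sgn c (by rw [abs_of_pos (by linarith [hc.1])]; linarith [hc.2]) hc.1.ne'
    have h2 : 0 < h c := (div_pos_iff_of_pos_right (by linarith [hc.1])).1 h1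
    rw [hcd, div_pos_iff_of_pos_right (by linarith)] at h2
    have := hmax (show y ∈ Icc 0 L from ⟨by linarith [hx₀.1], hyL.le⟩)
    simp only [mem_ofPred_eq] at this
    linarith
  · have hx₀L : x₀ = L := le_antisymm hx₀.2 hge
    obtain ⟨y, hy₁, hy₂⟩ : ∃ y, max (x₀ - ε) 0 < y ∧ y < x₀ :=
      exists_between (max_lt (by linarith) (by linarith))
    have hyε := (le_max_left _ _).trans_lt hy₁
    have hy0 := (le_max_right _ _).trans_lt hy₁
    obtain ⟨c, hc, hcd⟩ := exists_hasDerivAt_eq_slope g h hy₂ cg.continuousOn (fun x _ => dg x)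
    have h1 := sgn c (by rw [abs_of_neg (by linarith [hc.2])]; linarith [hc.1]) hc.2.ne
    have h2 : h c < 0 := by
      by_contra! h3
      exact absurd h1 (not_lt.2 (div_nonpos_of_nonneg_of_nonpos h3 (by linarith [hc.2])))
    rw [hcd, div_neg_iff] at h2
    have := hmax (show y ∈ Icc 0 L from ⟨hy0.le, by linarith⟩)
    simp only [mem_ofPred_eq] at this
    rcases h2 with h2 | h2 <;> linarith [h2.1, h2.2]

/-- The bound `sup |w'| ≤ sup |u'|`, uniform in `α`. -/
theorem abs_filterDer_le (hα : 0 < α) (hL : 0 < L) {u' : ℝ → ℝ} (hu : ∀ x, HasDerivAt u (u' x) x)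
    {m : ℝ} (hm : ∀ x ∈ Icc 0 L, |u' x| ≤ m) : ∀ x ∈ Icc 0 L, |filterDer α L u x| ≤ m := by
  intro x hx
  have hc : Continuous u := continuous_iff_continuousAt.2 fun x => (hu x).continuousAt
  refine abs_le.2 ⟨?_, filterDer_le hα hL hu (fun x hx => (abs_le.1 (hm x hx)).2) x hx⟩
  have hneg : ∀ x, HasDerivAt (fun s => (fun _ => (0 : ℝ)) s - u s) (0 - u' x) x := fun x =>
    (hasDerivAt_const x (0 : ℝ)).sub (hu x)
  have := filterDer_le hα hL hneg (m := m) (fun x hx => by linarith [(abs_le.1 (hm x hx)).1]) x hx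
  rw [filterDer_sub α L continuous_const hc, filterDer_const_zero] at this
  linarith

end MaximumPrinciple

end Elliptic

end BurgersAlpha

namespace BurgersAlpha

/-! ### Global flows of bounded scalar vector fields -/

section Flow

/-- `φ t ξ` is the flow of the time-dependent vector field `b` with spatial derivative `bx`
bounded by `K`, and `ψ t` is the inverse of `φ t`. -/
structure IsFlow (b bx : ℝ → ℝ → ℝ) (K : ℝ) (φ ψ : ℝ → ℝ → ℝ) : Prop where
  zero : ∀ ξ, φ 0 ξ = ξ
  time : ∀ t ξ, HasDerivAt (fun s => φ s ξ) (b t (φ t ξ)) t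
  space : ∀ t ξ, HasDerivAt (φ t) (Real.exp (∫ s in (0 : ℝ)..t, bx s (φ s ξ))) ξ
  left_inv : ∀ t ξ, ψ t (φ t ξ) = ξ
  right_inv : ∀ t x, φ t (ψ t x) = x
  continuous_flow : Continuous fun q : ℝ × ℝ => φ q.1 q.2
  contDiff_inv : ContDiff ℝ 1 fun q : ℝ × ℝ => ψ q.1 q.2
  -- This lower Lipschitz bound carries estimates on flows over to their inverses.
  expansive : ∀ t ξ η, |ξ - η| ≤ Real.exp (K * |t|) * |φ t ξ - φ t η|

variable {b bx : ℝ → ℝ → ℝ} {B K : ℝ}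

/-- Global solvability of a scalar ODE with bounded, Lipschitz right-hand side. -/
theorem exists_global_solution (hb : Continuous fun q : ℝ × ℝ => b q.1 q.2)
    (hB : ∀ t x, |b t x| ≤ B) {K : NNReal} (hK : ∀ t, LipschitzWith K (b t)) (ξ : ℝ) :
    ∃ f : ℝ → ℝ, f 0 = ξ ∧ ∀ t, HasDerivAt f (b t (f t)) t := by
  have hB0 : 0 ≤ B := (abs_nonneg _).trans (hB 0 0)
  have step : ∀ n : ℕ, ∃ f : ℝ → ℝ, f 0 = ξ ∧
      ∀ t ∈ Ioo (-(n + 1 : ℝ)) (n + 1), HasDerivAt f (b t (f t)) t := by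
    intro n
    have hn : (0 : ℝ) ≤ n := n.cast_nonneg
    have hmem : (0 : ℝ) ∈ Icc (-(n + 1 : ℝ)) (n + 1) := ⟨by linarith, by linarith⟩
    -- A solution cannot move further than `B (n + 1)` in this time, so a ball of that radius is
    -- never left.
    have hP : IsPicardLindelof b (⟨0, hmem⟩ : Icc (-(n + 1 : ℝ)) (n + 1)) ξ
        (B.toNNReal * (n + 1)) 0 B.toNNReal K :=
      { lipschitzOnWith := fun t _ => (hK t).lipschitzOnWith
        continuousOn := fun x _ =>
          (hb.comp (by fun_prop : Continuous fun t : ℝ => (t, x))).continuousOn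
        norm_le := fun t _ x _ => by
          rw [Real.coe_toNNReal _ hB0]; exact hB t x
        mul_max_le := by simp }
    obtain ⟨f, hf0, hf⟩ := hP.exists_eq_forall_mem_Icc_hasDerivWithinAt₀
    exact ⟨f, hf0, fun t ht => (hf t (Ioo_subset_Icc_self ht)).hasDerivAt (Icc_mem_nhds ht.1 ht.2)⟩
  choose f hf0 hf using step
  have agree : ∀ n m : ℕ, n ≤ m → ∀ t ∈ Ioo (-(n + 1 : ℝ)) (n + 1), f n t = f m t := by
    intro n m hnm t ht
    have hc : (n : ℝ) ≤ m := Nat.cast_le.2 hnm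
    refine ODE_solution_unique_of_mem_Ioo (v := b) (s := fun _ => univ) (K := K) (t₀ := 0)
      (fun t _ => (hK t).lipschitzOnWith) ?_ (fun s hs => ⟨hf n s hs, mem_univ _⟩)
      (fun s hs => ⟨hf m s ⟨by linarith [hs.1], by linarith [hs.2]⟩, mem_univ _⟩)
      (by rw [hf0, hf0]) ht
    have hn : (0 : ℝ) ≤ n := n.cast_nonneg
    exact ⟨by linarith, by linarith⟩
  refine ⟨fun t => f ⌈|t|⌉₊ t, hf0 _, fun t => ?_⟩
  have hmem : ∀ s : ℝ, s ∈ Ioo (-((⌈|s|⌉₊ : ℝ) + 1)) (⌈|s|⌉₊ + 1) := fun s => by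
    have h := Nat.le_ceil |s|
    have h' := abs_le.1 h
    exact ⟨by linarith [h'.1], by linarith [h'.2]⟩
  -- One index larger than needed at `t` itself, so that the single solution `f N` agrees with the
  -- glued one on a whole neighbourhood of `t`.
  set N := ⌈|t|⌉₊ + 1 with hN
  have hev : (fun s => f ⌈|s|⌉₊ s) =ᶠ[𝓝 t] f N := by
    filter_upwards [Metric.ball_mem_nhds t one_pos] with s hs
    refine agree _ _ ?_ s (hmem s)
    rw [hN, Nat.ceil_le]
    push_cast
    have h1 : |s| ≤ |t| + |s - t| := by
      have := abs_add_le t (s - t)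
      simpa using this
    rw [Metric.mem_ball, Real.dist_eq] at hs
    linarith [Nat.le_ceil |t|]
  have ht : t ∈ Ioo (-((N : ℝ) + 1)) (N + 1) := by
    have := hmem t
    rw [hN]
    push_cast
    exact ⟨by linarith [this.1], by linarith [this.2]⟩
  have hd := (hf N t ht).congr_of_eventuallyEq hev
  have he : f ⌈|t|⌉₊ t = f N t := hev.self_of_nhds
  simpa only [he] using hd

/-- The mean of `bx t` over the segment from `y` to `x`. -/
noncomputable def segmentMean (bx : ℝ → ℝ → ℝ) (t x y : ℝ) : ℝ :=
  ∫ θ in (0 : ℝ)..1, bx t (y + θ * (x - y))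

theorem segmentMean_self (bx : ℝ → ℝ → ℝ) (t x : ℝ) : segmentMean bx t x x = bx t x := by
  simp [segmentMean]

theorem continuous_segmentMean (hbx : Continuous fun q : ℝ × ℝ => bx q.1 q.2) :
    Continuous fun q : ℝ × ℝ × ℝ => segmentMean bx q.1 q.2.1 q.2.2 :=
  intervalIntegral.continuous_parametric_intervalIntegral_of_continuous'
    (f := fun (q : ℝ × ℝ × ℝ) θ => bx q.1 (q.2.2 + θ * (q.2.1 - q.2.2)))
    (hbx.comp (by fun_prop : Continuous fun r : (ℝ × ℝ × ℝ) × ℝ =>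
      (r.1.1, r.1.2.2 + r.2 * (r.1.2.1 - r.1.2.2)))) 0 1

/-- Hadamard's lemma. The difference of two trajectories thereby solves a scalar linear equation
exactly, so difference quotients of the flow have a closed exponential form. -/
theorem sub_eq_segmentMean_mul (hbx : Continuous fun q : ℝ × ℝ => bx q.1 q.2)
    (hd : ∀ t x, HasDerivAt (b t) (bx t x) x) (t x y : ℝ) :
    b t x - b t y = segmentMean bx t x y * (x - y) := by
  have h : ∀ θ ∈ uIcc (0 : ℝ) 1, HasDerivAt (fun θ => b t (y + θ * (x - y)))
      (bx t (y + θ * (x - y)) * (x - y)) θ := fun θ _ => by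
    have h1 : HasDerivAt (fun θ : ℝ => y + θ * (x - y)) (x - y) θ := by
      simpa using ((hasDerivAt_id θ).mul_const (x - y)).const_add y
    exact (hd t _).comp θ h1
  have hc : Continuous fun θ : ℝ => bx t (y + θ * (x - y)) * (x - y) :=
    (hbx.comp (by fun_prop : Continuous fun θ : ℝ => (t, y + θ * (x - y)))).mul continuous_const
  have := intervalIntegral.integral_eq_sub_of_hasDerivAt h (hc.intervalIntegrable _ _)
  rw [intervalIntegral.integral_mul_const] at this
  simpa [segmentMean] using this.symm

theorem abs_segmentMean_le (hK : ∀ t x, |bx t x| ≤ K) (t x y : ℝ) : |segmentMean bx t x y| ≤ K := by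
  have := intervalIntegral.norm_integral_le_of_norm_le_const (a := (0 : ℝ)) (b := 1) (C := K)
    (f := fun θ => bx t (y + θ * (x - y))) (fun θ _ => hK _ _)
  simpa [segmentMean] using this

/-- Solutions of a scalar linear ODE are exponentials. -/
theorem eq_mul_exp_of_hasDerivAt {d a : ℝ → ℝ} (ha : Continuous a)
    (hd : ∀ t, HasDerivAt d (a t * d t) t) (t : ℝ) :
    d t = d 0 * Real.exp (∫ s in (0 : ℝ)..t, a s) := by
  have hI : ∀ t, HasDerivAt (fun t => ∫ s in (0 : ℝ)..t, a s) (a t) t := fun t =>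
    (ha.integral_hasStrictDerivAt 0 t).hasDerivAt
  have hz : ∀ t, HasDerivAt (fun t => d t * Real.exp (-∫ s in (0 : ℝ)..t, a s)) 0 t := fun t =>
    ((hd t).mul (hI t).neg.exp).congr_deriv (by ring)
  have hconst := is_const_of_deriv_eq_zero (fun t => (hz t).differentiableAt)
    (fun t => (hz t).deriv) t 0
  simp only [intervalIntegral.integral_same, neg_zero, Real.exp_zero, mul_one] at hconst
  rw [← hconst, mul_assoc, ← Real.exp_add]
  simp

theorem abs_integral_le_mul_abs {a : ℝ → ℝ} (ha : ∀ t, |a t| ≤ K) (t : ℝ) :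
    |∫ s in (0 : ℝ)..t, a s| ≤ K * |t| := by
  have := intervalIntegral.norm_integral_le_of_norm_le_const (a := (0 : ℝ)) (b := t) (C := K)
    (f := a) (fun s _ => ha s)
  simpa using this

/-- The exponential formula for `φ t ξ - φ t η` yields the Lipschitz bounds in both directions and,
as `η → ξ`, the spatial derivative. Bounded displacement gives surjectivity, and the inverse
function theorem in space-time gives a `C¹` inverse. -/
theorem exists_isFlow (hb : Continuous fun q : ℝ × ℝ => b q.1 q.2)
    (hbx : Continuous fun q : ℝ × ℝ => bx q.1 q.2) (hd : ∀ t x, HasDerivAt (b t) (bx t x) x)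
    (hB : ∀ t x, |b t x| ≤ B) (hK : ∀ t x, |bx t x| ≤ K) :
    ∃ φ ψ : ℝ → ℝ → ℝ, IsFlow b bx K φ ψ := by
  have hB0 : 0 ≤ B := (abs_nonneg _).trans (hB 0 0)
  have hK0 : 0 ≤ K := (abs_nonneg _).trans (hK 0 0)
  have hlip : ∀ t, LipschitzWith K.toNNReal (b t) := fun t =>
    lipschitzWith_of_nnnorm_deriv_le (fun x => (hd t x).differentiableAt) fun x => by
      rw [(hd t x).deriv, ← NNReal.coe_le_coe, coe_nnnorm, Real.coe_toNNReal _ hK0]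
      exact hK t x
  choose f hf0 hf using fun ξ => exists_global_solution hb hB hlip ξ
  set φ : ℝ → ℝ → ℝ := fun t ξ => f ξ t with hφ
  have htime : ∀ t ξ, HasDerivAt (fun s => φ s ξ) (b t (φ t ξ)) t := fun t ξ => hf ξ t
  have hcont_t : ∀ ξ, Continuous fun t => φ t ξ := fun ξ =>
    continuous_iff_continuousAt.2 fun t => (htime t ξ).continuousAt
  have hmeanc : ∀ ξ η, Continuous fun s => segmentMean bx s (φ s ξ) (φ s η) := fun ξ η =>
    (continuous_segmentMean hbx).comp
      (continuous_id.prodMk ((hcont_t ξ).prodMk (hcont_t η)))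
  have hslope : ∀ t ξ η, φ t ξ - φ t η =
      (ξ - η) * Real.exp (∫ s in (0 : ℝ)..t, segmentMean bx s (φ s ξ) (φ s η)) := by
    intro t ξ η
    have := eq_mul_exp_of_hasDerivAt (d := fun t => φ t ξ - φ t η) (hmeanc ξ η) (fun t => by
      rw [← sub_eq_segmentMean_mul hbx hd]
      exact (htime t ξ).sub (htime t η)) t
    simpa only [hφ, hf0] using this
  have hIle : ∀ t ξ η, |∫ s in (0 : ℝ)..t, segmentMean bx s (φ s ξ) (φ s η)| ≤ K * |t| :=
    fun t ξ η => abs_integral_le_mul_abs (fun s => abs_segmentMean_le hK _ _ _) t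
  have hexp : ∀ t ξ η, |ξ - η| ≤ Real.exp (K * |t|) * |φ t ξ - φ t η| := by
    intro t ξ η
    rw [hslope, abs_mul, Real.abs_exp, mul_left_comm, ← Real.exp_add]
    refine le_mul_of_one_le_right (abs_nonneg _) (Real.one_le_exp ?_)
    linarith [(abs_le.1 (hIle t ξ η)).1]
  have hlipξ : ∀ t ξ η, |φ t ξ - φ t η| ≤ Real.exp (K * |t|) * |ξ - η| := by
    intro t ξ η
    rw [hslope, abs_mul, Real.abs_exp, mul_comm]
    exact mul_le_mul_of_nonneg_right (Real.exp_le_exp.2 (abs_le.1 (hIle t ξ η)).2) (abs_nonneg _)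
  have hcφ : Continuous fun q : ℝ × ℝ => φ q.1 q.2 := by
    refine continuous_prod_of_continuous_lipschitzWith _ B.toNNReal (fun t => ?_) (fun ξ => ?_)
    · refine (LipschitzWith.of_dist_le_mul (K := (Real.exp (K * |t|)).toNNReal)
        fun ξ η => ?_).continuous
      rw [Real.coe_toNNReal _ (Real.exp_pos _).le, Real.dist_eq, Real.dist_eq]
      exact hlipξ t ξ η
    · refine lipschitzWith_of_nnnorm_deriv_le (fun t => (htime t ξ).differentiableAt) fun t => ?_
      rw [(htime t ξ).deriv, ← NNReal.coe_le_coe, coe_nnnorm, Real.coe_toNNReal _ hB0]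
      exact hB _ _
  have hspace : ∀ t ξ, HasDerivAt (φ t) (Real.exp (∫ s in (0 : ℝ)..t, bx s (φ s ξ))) ξ := by
    intro t ξ
    have hQ : Continuous fun η : ℝ =>
        Real.exp (∫ s in (0 : ℝ)..t, segmentMean bx s (φ s η) (φ s ξ)) := by
      refine Real.continuous_exp.comp
        (intervalIntegral.continuous_parametric_intervalIntegral_of_continuous'
          (f := fun η s => segmentMean bx s (φ s η) (φ s ξ)) ?_ 0 t)
      exact (continuous_segmentMean hbx).comp (continuous_snd.prodMk
        ((hcφ.comp (by fun_prop : Continuous fun p : ℝ × ℝ => (p.2, p.1))).prodMk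
          ((hcont_t ξ).comp continuous_snd)))
    rw [hasDerivAt_iff_tendsto_slope]
    have hlim := (hQ.tendsto ξ).mono_left (nhdsWithin_le_nhds (s := {ξ}ᶜ))
    simp only [segmentMean_self] at hlim
    refine hlim.congr' ?_
    filter_upwards [self_mem_nhdsWithin] with η hη
    have hne : η - ξ ≠ 0 := sub_ne_zero.2 hη
    rw [slope_def_field, hslope, mul_div_cancel_left₀ _ hne]
  have hsurj : ∀ t, Function.Surjective (φ t) := by
    intro t
    have hdist : ∀ ξ, |φ t ξ - ξ| ≤ B * |t| := by
      intro ξ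
      have := Convex.norm_image_sub_le_of_norm_hasDerivWithin_le (C := B)
        (fun s (_ : s ∈ (univ : Set ℝ)) => (htime s ξ).hasDerivWithinAt)
        (fun s _ => hB s _) convex_univ (mem_univ 0) (mem_univ t)
      simpa [hφ, hf0] using this
    refine Continuous.surjective (hcφ.comp (by fun_prop : Continuous fun ξ : ℝ => (t, ξ))) ?_ ?_
    · exact tendsto_atTop_mono (fun ξ => by linarith [(abs_le.1 (hdist ξ)).1] :
        ∀ ξ : ℝ, ξ + -(B * |t|) ≤ φ t ξ) (tendsto_atTop_add_const_right _ _ tendsto_id)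
    · exact tendsto_atBot_mono (fun ξ => by linarith [(abs_le.1 (hdist ξ)).2] :
        ∀ ξ : ℝ, φ t ξ ≤ ξ + B * |t|) (tendsto_atBot_add_const_right _ _ tendsto_id)
  choose ψ hψ using hsurj
  have hleft : ∀ t ξ, ψ t (φ t ξ) = ξ := by
    intro t ξ
    have := hexp t (ψ t (φ t ξ)) ξ
    rw [hψ, sub_self, abs_zero, mul_zero] at this
    exact sub_eq_zero.1 (abs_eq_zero.1 (le_antisymm this (abs_nonneg _)))
  refine ⟨φ, ψ, hf0, htime, hspace, hleft, hψ, hcφ, ?_, hexp⟩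
  -- the space-time map and its inverse
  set Dξ : ℝ → ℝ → ℝ := fun t ξ => Real.exp (∫ s in (0 : ℝ)..t, bx s (φ s ξ)) with hDξ
  have cD : Continuous fun q : ℝ × ℝ => Dξ q.1 q.2 := by
    refine Real.continuous_exp.comp ?_
    exact intervalIntegral.continuous_parametric_intervalIntegral_of_continuous
      (f := fun (q : ℝ × ℝ) s => bx s (φ s q.2))
      (hbx.comp (continuous_snd.prodMk (hcφ.comp
        (by fun_prop : Continuous fun p : (ℝ × ℝ) × ℝ => (p.2, p.1.2))))) continuous_fst
  have cT : Continuous fun q : ℝ × ℝ => b q.1 (φ q.1 q.2) := hb.comp (continuous_fst.prodMk hcφ)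
  have hCD : ContDiff ℝ 1 fun q : ℝ × ℝ => φ q.1 q.2 :=
    contDiff_one_of_partials htime hspace cT cD
  have hstrict := hasStrictFDerivAt_of_partials htime hspace cT cD
  -- The derivative of `(t, ξ) ↦ (t, φ t ξ)` is triangular with diagonal entries `1` and `Dξ > 0`,
  -- so its inverse is explicit.
  set e : ℝ × ℝ → (ℝ × ℝ) ≃L[ℝ] ℝ × ℝ := fun q =>
    ContinuousLinearEquiv.equivOfInverse
      ((ContinuousLinearMap.fst ℝ ℝ ℝ).prod
        ((ContinuousLinearMap.toSpanSingleton ℝ (b q.1 (φ q.1 q.2))).coprod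
        (ContinuousLinearMap.toSpanSingleton ℝ (Dξ q.1 q.2))))
      ((ContinuousLinearMap.fst ℝ ℝ ℝ).prod
        ((ContinuousLinearMap.toSpanSingleton ℝ (-b q.1 (φ q.1 q.2) / Dξ q.1 q.2)).coprod
        (ContinuousLinearMap.toSpanSingleton ℝ (1 / Dξ q.1 q.2))))
      (fun p => by
        have : Dξ q.1 q.2 ≠ 0 := (Real.exp_pos _).ne'
        ext
        · simp
        · simp; field_simp; ring)
      (fun p => by
        have : Dξ q.1 q.2 ≠ 0 := (Real.exp_pos _).ne'
        ext
        · simp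
        · simp; field_simp; ring) with he
  have hF : ∀ q, HasStrictFDerivAt (fun q : ℝ × ℝ => (q.1, φ q.1 q.2))
      (e q : ℝ × ℝ →L[ℝ] ℝ × ℝ) q := fun q => hasStrictFDerivAt_fst.prodMk (hstrict q)
  set E : ℝ × ℝ ≃ ℝ × ℝ :=
    { toFun := fun q => (q.1, φ q.1 q.2)
      invFun := fun q => (q.1, ψ q.1 q.2)
      left_inv := fun q => by simp [hleft]
      right_inv := fun q => by simp [hψ] } with hE
  have hopen : IsOpenMap E := isOpenMap_of_hasStrictFDerivAt_equiv hF
  have hsymm := (E.toHomeomorphOfContinuousOpen (continuous_fst.prodMk hcφ) hopen).contDiff_symm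
    (n := 1) (fun q => (hF q).hasFDerivAt) (contDiff_fst.prodMk hCD)
  exact contDiff_snd.comp hsymm

end Flow

/-! ### Stability of flows in a weighted norm -/

section Comparison

variable {b₁ b₂ bx₁ bx₂ φ₁ φ₂ ψ₁ ψ₂ : ℝ → ℝ → ℝ} {K k ε T : ℝ}

/-- Continuous dependence of the flow on the vector field, in an exponentially weighted norm. -/
theorem IsFlow.abs_sub_le (h₁ : IsFlow b₁ bx₁ K φ₁ ψ₁) (h₂ : IsFlow b₂ bx₂ K φ₂ ψ₂)
    (hd : ∀ t x, HasDerivAt (b₁ t) (bx₁ t x) x) (hK : ∀ t x, |bx₁ t x| ≤ K) (hk : K < k)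
    (hε : 0 ≤ ε) (hdiff : ∀ t ∈ Icc 0 T, ∀ x, |b₁ t x - b₂ t x| ≤ ε * Real.exp (k * t))
    {t : ℝ} (ht : t ∈ Icc 0 T) (ξ : ℝ) :
    |φ₁ t ξ - φ₂ t ξ| ≤ 2 * ε / (k - K) * Real.exp (k * t) := by
  have hK0 : 0 ≤ K := (abs_nonneg _).trans (hK 0 0)
  have hlip : ∀ t x y, |b₁ t x - b₁ t y| ≤ K * |x - y| := fun t x y => by
    have := Convex.norm_image_sub_le_of_norm_hasDerivWithin_le (C := K)
      (fun s (_ : s ∈ (univ : Set ℝ)) => (hd t s).hasDerivWithinAt)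
      (fun s _ => hK t s) convex_univ (mem_univ y) (mem_univ x)
    exact this
  have hkK : 0 < k - K := sub_pos.2 hk
  -- The barrier argument needs a strict inequality of derivatives at contact, which fails for `ε =
  -- 0`; hence `δ > ε` and a limit at the end.
  have main : ∀ δ > ε, |φ₁ t ξ - φ₂ t ξ| ≤ 2 * δ / (k - K) * Real.exp (k * t) := by
    intro δ hδ
    have hδ0 : 0 < δ := hε.trans_lt hδ
    have hder : ∀ s, HasDerivAt (fun s => φ₁ s ξ - φ₂ s ξ)
        (b₁ s (φ₁ s ξ) - b₂ s (φ₂ s ξ)) s := fun s => (h₁.time s ξ).sub (h₂.time s ξ)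
    have hB : ∀ s, HasDerivAt (fun s => 2 * δ / (k - K) * Real.exp (k * s))
        (2 * δ / (k - K) * (Real.exp (k * s) * k)) s := fun s => by
      have h1 : HasDerivAt (fun s : ℝ => k * s) k s := by
        simpa using (hasDerivAt_id s).const_mul k
      exact h1.exp.const_mul _
    refine image_norm_le_of_norm_deriv_right_lt_deriv_boundary (a := 0) (b := T)
      (f := fun s => φ₁ s ξ - φ₂ s ξ)
      (fun s _ => (hder s).continuousAt.continuousWithinAt)
      (fun s _ => (hder s).hasDerivWithinAt) ?_ hB ?_ ht
    · simp only [h₁.zero, h₂.zero, sub_self, norm_zero]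
      positivity
    · intro s hs hEq
      rw [Real.norm_eq_abs] at hEq ⊢
      have e1 : b₁ s (φ₁ s ξ) - b₂ s (φ₂ s ξ) =
          (b₁ s (φ₁ s ξ) - b₁ s (φ₂ s ξ)) + (b₁ s (φ₂ s ξ) - b₂ s (φ₂ s ξ)) := by ring
      have e2 := hlip s (φ₁ s ξ) (φ₂ s ξ)
      have e3 := hdiff s ⟨hs.1, hs.2.le⟩ (φ₂ s ξ)
      rw [hEq] at e2
      rw [e1]
      refine (abs_add_le _ _).trans_lt ((add_le_add e2 e3).trans_lt ?_)
      have hx := Real.exp_pos (k * s)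
      have key : 2 * δ / (k - K) * (Real.exp (k * s) * k) =
          K * (2 * δ / (k - K) * Real.exp (k * s)) + 2 * δ * Real.exp (k * s) := by
        field_simp; ring
      rw [key]
      nlinarith
  have hlim : Tendsto (fun δ => 2 * δ / (k - K) * Real.exp (k * t)) (𝓝[>] ε)
      (𝓝 (2 * ε / (k - K) * Real.exp (k * t))) :=
    ((by fun_prop : Continuous fun δ => 2 * δ / (k - K) * Real.exp (k * t)).tendsto ε).mono_left
      nhdsWithin_le_nhds
  exact ge_of_tendsto hlim (eventually_nhdsWithin_of_forall fun δ hδ => main δ hδ)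

/-- Continuous dependence of the inverse flow on the vector field. -/
theorem IsFlow.abs_inv_sub_le (h₁ : IsFlow b₁ bx₁ K φ₁ ψ₁) (h₂ : IsFlow b₂ bx₂ K φ₂ ψ₂)
    (hd : ∀ t x, HasDerivAt (b₁ t) (bx₁ t x) x) (hK : ∀ t x, |bx₁ t x| ≤ K) (hk : K < k)
    (hε : 0 ≤ ε) (hdiff : ∀ t ∈ Icc 0 T, ∀ x, |b₁ t x - b₂ t x| ≤ ε * Real.exp (k * t))
    {t : ℝ} (ht : t ∈ Icc 0 T) (x : ℝ) :
    |ψ₁ t x - ψ₂ t x| ≤ Real.exp (K * T) * (2 * ε / (k - K)) * Real.exp (k * t) := by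
  have hK0 : 0 ≤ K := (abs_nonneg _).trans (hK 0 0)
  -- Since `x = φ₁ t (ψ₁ t x) = φ₂ t (ψ₂ t x)`, the right-hand side compares the two flows at the
  -- common starting point `ψ₂ t x`.
  have e1 := h₁.expansive t (ψ₁ t x) (ψ₂ t x)
  have e2 := h₁.abs_sub_le h₂ hd hK hk hε hdiff ht (ψ₂ t x)
  rw [h₁.right_inv, abs_sub_comm x, abs_of_nonneg ht.1] at e1
  rw [h₂.right_inv] at e2
  have e3 : Real.exp (K * t) ≤ Real.exp (K * T) :=
    Real.exp_le_exp.2 (mul_le_mul_of_nonneg_left ht.2 hK0)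
  rw [mul_assoc]
  exact e1.trans (mul_le_mul e3 e2 (abs_nonneg _) (Real.exp_pos _).le)

end Comparison

end BurgersAlpha

namespace BurgersAlpha

/-! ### Projection onto an interval -/

section Clamp

/-- The projection of `ℝ` onto `[a, b]`. -/
noncomputable def clamp (a b x : ℝ) : ℝ := max a (min b x)

variable {a b x y : ℝ}

theorem clamp_mem (h : a ≤ b) (x : ℝ) : clamp a b x ∈ Icc a b :=
  ⟨le_max_left _ _, max_le h (min_le_left _ _)⟩

theorem clamp_of_mem (h : x ∈ Icc a b) : clamp a b x = x := by
  rw [clamp, min_eq_right h.2, max_eq_right h.1]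

theorem clamp_of_le (hab : a ≤ b) (h : x ≤ a) : clamp a b x = a := by
  rw [clamp, min_eq_right (h.trans hab), max_eq_left h]

theorem clamp_of_ge (hab : a ≤ b) (h : b ≤ x) : clamp a b x = b := by
  rw [clamp, min_eq_left h, max_eq_right hab]

theorem continuous_clamp (a b : ℝ) : Continuous (clamp a b) := by
  unfold clamp
  fun_prop

theorem abs_clamp_sub_le (a b x y : ℝ) : |clamp a b x - clamp a b y| ≤ |x - y| := by
  unfold clamp
  refine (abs_max_sub_max_le_max _ _ _ _).trans (max_le (by simp) ?_)
  exact (abs_min_sub_min_le_max _ _ _ _).trans (max_le (by simp) le_rfl)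

end Clamp

/-! ### Bounded `C¹` extension from `[0, L]` to the line -/

section Extension

/-- A bounded `C¹` extension to `ℝ` of a function `f` on `[0, L]` with derivative `f'`. -/
noncomputable def sinExt (L : ℝ) (f f' : ℝ → ℝ) (x : ℝ) : ℝ :=
  f (clamp 0 L x) + f' (clamp 0 L x) * Real.sin (x - clamp 0 L x)

/-- The derivative of `sinExt L f f'`. -/
noncomputable def sinExtDer (L : ℝ) (f' : ℝ → ℝ) (x : ℝ) : ℝ :=
  f' (clamp 0 L x) * Real.cos (x - clamp 0 L x)

variable {L M M' : ℝ} {f f' g g' : ℝ → ℝ}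

theorem sinExt_of_mem {x : ℝ} (hx : x ∈ Icc 0 L) : sinExt L f f' x = f x := by
  simp [sinExt, clamp_of_mem hx]

theorem sinExtDer_of_mem {x : ℝ} (hx : x ∈ Icc 0 L) : sinExtDer L f' x = f' x := by
  simp [sinExtDer, clamp_of_mem hx]

theorem hasDerivAt_sinExt (hL : 0 ≤ L)
    (hf : ∀ x ∈ Icc 0 L, HasDerivWithinAt f (f' x) (Icc 0 L) x) (x : ℝ) :
    HasDerivAt (sinExt L f f') (sinExtDer L f' x) x := by
  have hsin : ∀ c x : ℝ, HasDerivAt (fun x => f c + f' c * Real.sin (x - c))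
      (f' c * Real.cos (x - c)) x := fun c x => by
    simpa using ((((hasDerivAt_id x).sub_const c).sin).const_mul (f' c)).const_add (f c)
  -- Differentiability is checked within three closed sets covering `ℝ`; at a point outside one of
  -- them the claim for that set is vacuous.
  have h1 : HasDerivWithinAt (sinExt L f f') (sinExtDer L f' x) (Iic 0) x := by
    by_cases hx : x ∈ Iic (0 : ℝ)
    · have e : ∀ y ∈ Iic (0 : ℝ), clamp 0 L y = 0 := fun y hy => clamp_of_le hL hy
      simp only [sinExtDer, e x hx]
      exact (hsin 0 x).hasDerivWithinAt.congr (fun y hy => by simp only [sinExt, e y hy])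
        (by simp only [sinExt, e x hx])
    · exact HasFDerivWithinAt.of_notMem_closure (by rwa [isClosed_Iic.closure_eq])
  have h2 : HasDerivWithinAt (sinExt L f f') (sinExtDer L f' x) (Icc 0 L) x := by
    by_cases hx : x ∈ Icc 0 L
    · rw [sinExtDer_of_mem hx]
      exact (hf x hx).congr (fun y hy => sinExt_of_mem hy) (sinExt_of_mem hx)
    · exact HasFDerivWithinAt.of_notMem_closure (by rwa [isClosed_Icc.closure_eq])
  have h3 : HasDerivWithinAt (sinExt L f f') (sinExtDer L f' x) (Ici L) x := by
    by_cases hx : x ∈ Ici L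
    · have e : ∀ y ∈ Ici L, clamp 0 L y = L := fun y hy => clamp_of_ge hL hy
      simp only [sinExtDer, e x hx]
      exact (hsin L x).hasDerivWithinAt.congr (fun y hy => by simp only [sinExt, e y hy])
        (by simp only [sinExt, e x hx])
    · exact HasFDerivWithinAt.of_notMem_closure (by rwa [isClosed_Ici.closure_eq])
  have h := (h1.union h2).union h3
  rwa [Iic_union_Icc_eq_Iic hL, Iic_union_Ici, hasDerivWithinAt_univ] at h

theorem abs_sinExt_le (hL : 0 ≤ L) (hf : ∀ x ∈ Icc 0 L, |f x| ≤ M)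
    (hf' : ∀ x ∈ Icc 0 L, |f' x| ≤ M') (x : ℝ) : |sinExt L f f' x| ≤ M + M' := by
  refine (abs_add_le _ _).trans (add_le_add (hf _ (clamp_mem hL x)) ?_)
  rw [abs_mul]
  exact (mul_le_of_le_one_right (abs_nonneg _) (Real.abs_sin_le_one _)).trans
    (hf' _ (clamp_mem hL x))

theorem abs_sinExtDer_le (hL : 0 ≤ L) (hf' : ∀ x ∈ Icc 0 L, |f' x| ≤ M') (x : ℝ) :
    |sinExtDer L f' x| ≤ M' := by
  rw [sinExtDer, abs_mul]
  exact (mul_le_of_le_one_right (abs_nonneg _) (Real.abs_cos_le_one _)).trans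
    (hf' _ (clamp_mem hL x))

theorem sinExt_sub (x : ℝ) : sinExt L f f' x - sinExt L g g' x =
    sinExt L (fun s => f s - g s) (fun s => f' s - g' s) x := by
  unfold sinExt
  ring

end Extension

/-! ### The velocity field on the whole line -/

section Velocity

/-- The velocity `w` produced by the density `u`, extended to `ℝ`. -/
noncomputable def velocity (α L : ℝ) (u : ℝ → ℝ) : ℝ → ℝ :=
  sinExt L (filterSol α L u) (filterDer α L u)

/-- The spatial derivative of `velocity`. -/
noncomputable def velocityDer (α L : ℝ) (u : ℝ → ℝ) : ℝ → ℝ := sinExtDer L (filterDer α L u)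

variable {α L : ℝ} {u v : ℝ → ℝ}

theorem hasDerivAt_velocity (α : ℝ) (hL : 0 ≤ L) (hu : Continuous u) (x : ℝ) :
    HasDerivAt (velocity α L u) (velocityDer α L u x) x :=
  hasDerivAt_sinExt hL (fun x _ => (hasDerivAt_filterSol α L hu x).hasDerivWithinAt) x

/-- The Lipschitz estimate is the bound applied to `u - v`, since both the filter and the extension
are linear. The constant depends on `α` and enters only the contraction argument. -/
theorem exists_velocity_bound (hα : 0 < α) (hL : 0 < L) :
    ∃ C : ℝ, 0 < C ∧ (∀ u : ℝ → ℝ, ∀ A : ℝ, (∀ x ∈ Icc 0 L, |u x| ≤ A) →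
      ∀ x, |velocity α L u x| ≤ C * A ∧ |velocityDer α L u x| ≤ C * A) ∧
      ∀ u v : ℝ → ℝ, Continuous u → Continuous v → ∀ A : ℝ, (∀ x ∈ Icc 0 L, |u x - v x| ≤ A) →
      ∀ x, |velocity α L u x - velocity α L v x| ≤ C * A := by
  obtain ⟨C, hC, h⟩ := exists_filter_bound hα hL
  have key : ∀ u : ℝ → ℝ, ∀ A : ℝ, (∀ x ∈ Icc 0 L, |u x| ≤ A) →
      ∀ x, |velocity α L u x| ≤ 2 * C * A ∧ |velocityDer α L u x| ≤ 2 * C * A := by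
    intro u A hA x
    have hA0 : 0 ≤ A := (abs_nonneg _).trans (hA 0 ⟨le_rfl, hL.le⟩)
    have h1 := abs_sinExt_le hL.le (fun x hx => (h u A hA x hx).1) (fun x hx => (h u A hA x hx).2) x
    have h2 := abs_sinExtDer_le hL.le (fun x hx => (h u A hA x hx).2) x
    have h3 := mul_nonneg hC.le hA0
    exact ⟨h1.trans (by linarith), h2.trans (by linarith)⟩
  refine ⟨2 * C, by positivity, key, fun u v hu hv A hA x => ?_⟩
  have := (key (fun s => u s - v s) A hA x).1
  simp only [velocity, funext (filterSol_sub α L hu hv), funext (filterDer_sub α L hu hv),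
    ← sinExt_sub] at this
  exact this

variable {U : ℝ → ℝ → ℝ}

theorem continuous_velocity (α L : ℝ) (c : Continuous fun q : ℝ × ℝ => U q.1 q.2) :
    Continuous fun q : ℝ × ℝ => velocity α L (U q.1) q.2 := by
  have hc : Continuous fun q : ℝ × ℝ => (q.1, clamp 0 L q.2) :=
    continuous_fst.prodMk ((continuous_clamp 0 L).comp continuous_snd)
  exact ((continuous_filterSol α L c).comp hc).add (((continuous_filterDer α L c).comp hc).mul
    (Real.continuous_sin.comp (continuous_snd.sub (continuous_snd.comp hc))))

theorem continuous_velocityDer (α L : ℝ) (c : Continuous fun q : ℝ × ℝ => U q.1 q.2) :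
    Continuous fun q : ℝ × ℝ => velocityDer α L (U q.1) q.2 := by
  have hc : Continuous fun q : ℝ × ℝ => (q.1, clamp 0 L q.2) :=
    continuous_fst.prodMk ((continuous_clamp 0 L).comp continuous_snd)
  exact ((continuous_filterDer α L c).comp hc).mul
    (Real.continuous_cos.comp (continuous_snd.sub (continuous_snd.comp hc)))

end Velocity

/-! ### Existence for fixed `α` by contraction -/

section FixedPoint

open BoundedContinuousFunction

/-- For fixed `α`, the density `U₀` transported by the velocity `ℓ + w` which it generates. -/
theorem exists_selfconsistent_flow {T L α : ℝ} (hT : 0 ≤ T) (hL : 0 < L) (hα : 0 < α) {ℓ : ℝ → ℝ}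
    (hℓ : Continuous ℓ) {U₀ U₀' : ℝ → ℝ} (hU : ∀ x, HasDerivAt U₀ (U₀' x) x) {A m : ℝ}
    (hA : ∀ x, |U₀ x| ≤ A) (hm : ∀ x, |U₀' x| ≤ m) :
    ∃ (b bx : ℝ → ℝ → ℝ) (K : ℝ) (φ ψ : ℝ → ℝ → ℝ), IsFlow b bx K φ ψ ∧
      (Continuous fun q : ℝ × ℝ => bx q.1 q.2) ∧
      ∀ t ∈ Icc 0 T, ∀ x, b t x = ℓ t + velocity α L (fun y => U₀ (ψ t y)) x ∧
        bx t x = velocityDer α L (fun y => U₀ (ψ t y)) x := by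
  have hA0 : 0 ≤ A := (abs_nonneg _).trans (hA 0)
  have hm0 : 0 ≤ m := (abs_nonneg _).trans (hm 0)
  have hcU : Continuous U₀ := continuous_iff_continuousAt.2 fun x => (hU x).continuousAt
  have hlipU : ∀ x y, |U₀ x - U₀ y| ≤ m * |x - y| := fun x y => by
    have := Convex.norm_image_sub_le_of_norm_hasDerivWithin_le (C := m)
      (fun s (_ : s ∈ (univ : Set ℝ)) => (hU s).hasDerivWithinAt)
      (fun s _ => hm s) convex_univ (mem_univ y) (mem_univ x)
    exact this
  obtain ⟨Λ, hΛ⟩ := (isCompact_Icc (a := 0) (b := T)).exists_bound_of_continuousOn hℓ.continuousOn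
  obtain ⟨C, hC, hbound, hdiff⟩ := exists_velocity_bound hα hL
  set K := C * A with hK
  have hK0 : 0 ≤ K := by positivity
  -- The Lipschitz constant of `Φ` will be `2 m C exp (K T) / (k - K)`, which this choice makes at
  -- most `1 / 2`; the `+ 1` keeps `k - K` positive when `m` vanishes.
  set k := K + 4 * (m * C * Real.exp (K * T)) + 1 with hk
  have hkK : 0 < k - K := by
    have : 0 ≤ m * C * Real.exp (K * T) := by positivity
    linarith
  have hk0 : 0 ≤ k := by linarith
  set τ : ℝ → ℝ := clamp 0 T with hτ
  have cτ : Continuous τ := continuous_clamp 0 T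
  have τmem : ∀ t, τ t ∈ Icc 0 T := clamp_mem hT
  -- The unknown `v` is the density times `exp (-k t)`, so the plain sup norm of `v` is the weighted
  -- one. Clamping in time and in value gives every `v` a globally defined field with the same
  -- bounds, so `Φ` acts on the whole Banach space.
  set V : (ℝ × ℝ →ᵇ ℝ) → ℝ → ℝ → ℝ := fun v t x =>
    clamp (-A) A (Real.exp (k * τ t) * v (τ t, x)) with hV
  have cV : ∀ v, Continuous fun q : ℝ × ℝ => V v q.1 q.2 := fun v => by
    refine (continuous_clamp (-A) A).comp ((Real.continuous_exp.comp
      (continuous_const.mul (cτ.comp continuous_fst))).mul (v.continuous.comp ?_))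
    exact (cτ.comp continuous_fst).prodMk continuous_snd
  have cVt : ∀ v t, Continuous (V v t) := fun v t =>
    (cV v).comp (by fun_prop : Continuous fun x : ℝ => (t, x))
  have bV : ∀ v t x, |V v t x| ≤ A := fun v t x => abs_le.2 (clamp_mem (by linarith) _)
  set b : (ℝ × ℝ →ᵇ ℝ) → ℝ → ℝ → ℝ := fun v t x => ℓ (τ t) + velocity α L (V v t) x with hb
  set bx : (ℝ × ℝ →ᵇ ℝ) → ℝ → ℝ → ℝ := fun v t x => velocityDer α L (V v t) x with hbx
  have db : ∀ v t x, HasDerivAt (b v t) (bx v t x) x := fun v t x =>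
    (hasDerivAt_velocity α hL.le (cVt v t) x).const_add _
  have bbx : ∀ v t x, |bx v t x| ≤ K := fun v t x => (hbound _ A (fun x _ => bV v t x) x).2
  have cbx : ∀ v, Continuous fun q : ℝ × ℝ => bx v q.1 q.2 := fun v =>
    continuous_velocityDer α L (cV v)
  have hflow : ∀ v, ∃ φ ψ : ℝ → ℝ → ℝ, IsFlow (b v) (bx v) K φ ψ := fun v =>
    exists_isFlow (B := Λ + K)
      (((hℓ.comp cτ).comp continuous_fst).add (continuous_velocity α L (cV v))) (cbx v) (db v)
      (fun t x => (abs_add_le _ _).trans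
        (add_le_add (hΛ _ (τmem t)) (hbound _ A (fun x _ => bV v t x) x).1)) (bbx v)
  choose φ ψ hφψ using hflow
  have bdiff : ∀ v₁ v₂ : ℝ × ℝ →ᵇ ℝ, ∀ t ∈ Icc 0 T, ∀ x,
      |b v₁ t x - b v₂ t x| ≤ C * dist v₁ v₂ * Real.exp (k * t) := by
    intro v₁ v₂ t ht x
    simp only [hb, add_sub_add_left_eq_sub]
    rw [mul_assoc]
    refine hdiff _ _ (cVt _ _) (cVt _ _) _ (fun y _ => ?_) x
    refine (abs_clamp_sub_le _ _ _ _).trans ?_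
    rw [← mul_sub, abs_mul, Real.abs_exp, mul_comm, hτ, clamp_of_mem ht]
    exact mul_le_mul_of_nonneg_right (dist_coe_le_dist (f := v₁) (g := v₂) (t, y))
      (Real.exp_pos _).le
  set Φ : (ℝ × ℝ →ᵇ ℝ) → (ℝ × ℝ →ᵇ ℝ) := fun v =>
    BoundedContinuousFunction.ofNormedAddCommGroup
      (fun q : ℝ × ℝ => Real.exp (-(k * τ q.1)) * U₀ (ψ v (τ q.1) q.2))
      ((Real.continuous_exp.comp (continuous_const.mul (cτ.comp continuous_fst)).neg).mul
        (hcU.comp ((hφψ v).contDiff_inv.continuous.comp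
          ((cτ.comp continuous_fst).prodMk continuous_snd)))) A
      (fun q => by
        rw [norm_mul, Real.norm_eq_abs, Real.abs_exp, Real.norm_eq_abs]
        have h1 : Real.exp (-(k * τ q.1)) ≤ 1 :=
          Real.exp_le_one_iff.2 (neg_nonpos.2 (mul_nonneg hk0 (τmem _).1))
        have h2 := mul_le_mul h1 (hA (ψ v (τ q.1) q.2)) (abs_nonneg _) zero_le_one
        rwa [one_mul] at h2) with hΦ
  have hΦapp : ∀ v t x, Φ v (t, x) = Real.exp (-(k * τ t)) * U₀ (ψ v (τ t) x) :=
    fun _ _ _ => rfl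
  have hcontr : ContractingWith (1 / 2) Φ := by
    refine ⟨by rw [← NNReal.coe_lt_coe]; norm_num, LipschitzWith.of_dist_le_mul fun v₁ v₂ => ?_⟩
    rw [BoundedContinuousFunction.dist_le (by positivity)]
    rintro ⟨t, x⟩
    have h1 := (hφψ v₁).abs_inv_sub_le (hφψ v₂) (db v₁) (bbx v₁) (sub_pos.1 hkK)
      (mul_nonneg hC.le dist_nonneg) (bdiff v₁ v₂) (τmem t) x
    rw [hΦapp, hΦapp, Real.dist_eq, ← mul_sub, abs_mul, Real.abs_exp]
    have h2 : |U₀ (ψ v₁ (τ t) x) - U₀ (ψ v₂ (τ t) x)| ≤ m * (Real.exp (K * T) *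
        (2 * (C * dist v₁ v₂) / (k - K)) * Real.exp (k * τ t)) :=
      (hlipU _ _).trans (mul_le_mul_of_nonneg_left h1 hm0)
    refine (mul_le_mul_of_nonneg_left h2 (Real.exp_pos _).le).trans ?_
    have h3 : Real.exp (-(k * τ t)) * Real.exp (k * τ t) = 1 := by
      rw [← Real.exp_add]; simp
    have h4 : Real.exp (-(k * τ t)) * (m * (Real.exp (K * T) *
        (2 * (C * dist v₁ v₂) / (k - K)) * Real.exp (k * τ t))) =
        2 * (m * C * Real.exp (K * T)) / (k - K) * dist v₁ v₂ *
        (Real.exp (-(k * τ t)) * Real.exp (k * τ t)) := by ring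
    rw [h4, h3, mul_one]
    refine mul_le_mul_of_nonneg_right ?_ dist_nonneg
    rw [div_le_iff₀ hkK, hk]
    push_cast
    linarith
  set v := hcontr.fixedPoint with hv
  have hfix : Φ v = v := hcontr.fixedPoint_isFixedPt
  refine ⟨b v, bx v, K, φ v, ψ v, hφψ v, cbx v, fun t ht x => ?_⟩
  have hτt : τ t = t := clamp_of_mem ht
  -- At the fixed point both clamps are inactive: `t` lies in `[0, T]`, and the transported density
  -- inherits the bound `A`.
  have hVeq : V v t = fun y => U₀ (ψ v t y) := by
    funext y
    have h1 : v (τ t, y) = Real.exp (-(k * τ t)) * U₀ (ψ v (τ t) y) := by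
      have := hΦapp v (τ t) y
      rwa [hfix, show τ (τ t) = τ t by rw [hτt, hτt]] at this
    rw [hτt] at h1
    simp only [hV, hτt, h1, ← mul_assoc, ← Real.exp_add, add_neg_cancel, Real.exp_zero, one_mul]
    exact clamp_of_mem (abs_le.1 (hA _))
  simp only [hb, hbx, hVeq, hτt, and_self]

end FixedPoint

end BurgersAlpha

namespace BurgersAlpha

/-! ### Transport with bounds uniform in `α` -/

section Density

theorem contDiff_one_of_hasDerivAt {f f' : ℝ → ℝ} (h : ∀ x, HasDerivAt f (f' x) x)
    (c : Continuous f') : ContDiff ℝ 1 f :=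
  contDiff_one_iff_deriv.2 ⟨fun x => (h x).differentiableAt, by
    rwa [funext fun x => (h x).deriv]⟩

theorem contDiff_two_filterSol {α L : ℝ} {u : ℝ → ℝ} (hα : α ≠ 0) (hu : Continuous u) :
    ContDiff ℝ 2 (filterSol α L u) := by
  have hd := hasDerivAt_filterSol α L hu
  have c : Continuous (filterSol α L u) := continuous_iff_continuousAt.2 fun x => (hd x).continuousAt
  rw [show (2 : WithTop ℕ∞) = 1 + 1 from rfl, contDiff_succ_iff_deriv,
    funext fun x => (hd x).deriv]
  exact ⟨fun x => (hd x).differentiableAt, by simp,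
    contDiff_one_of_hasDerivAt (hasDerivAt_filterDer hα L hu) (by fun_prop)⟩

/-- The transported density, with bounds that do not depend on `α`. -/
theorem exists_transported_density {T L α : ℝ} (hT : 0 ≤ T) (hL : 0 < L) (hα : 0 < α)
    {ℓ P : ℝ → ℝ} (hℓ : Continuous ℓ) (hP : ∀ t, HasDerivAt P (ℓ t) t) {U₀ U₀' : ℝ → ℝ}
    (hU : ∀ x, HasDerivAt U₀ (U₀' x) x) (cU : Continuous U₀') {A m : ℝ} (hA : ∀ x, |U₀ x| ≤ A)
    (hm : ∀ x, |U₀' x| ≤ m) (hsupp : ∀ x ≤ -1, U₀ x = 0) (hmT : m * T ≤ 1 / 2)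
    (hexit : L + 1 + (A + 2 * m * L + 2 * m) * T ≤ P T - P 0) :
    ∃ u u₁ u₂ : ℝ → ℝ → ℝ, (ContDiff ℝ 1 fun q : ℝ × ℝ => u q.1 q.2) ∧
      (∀ t x, HasDerivAt (fun s => u s x) (u₁ t x) t) ∧ (∀ t x, HasDerivAt (u t) (u₂ t x) x) ∧
      (∀ t ∈ Icc 0 T, ∀ x ∈ Icc 0 L, u₁ t x + (ℓ t + filterSol α L (u t) x) * u₂ t x = 0) ∧
      (∀ t x, |u t x| ≤ A) ∧ (∀ t ∈ Icc 0 T, ∀ x, |u₂ t x| ≤ 2 * m) ∧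
      (∀ x, u 0 x = U₀ x) ∧ ∀ x ≤ L, u T x = 0 := by
  obtain ⟨b, bx, K, φ, ψ, hφψ, cbx, hfield⟩ :=
    exists_selfconsistent_flow hT hL hα hℓ hU hA hm
  have hm0 : 0 ≤ m := (abs_nonneg _).trans (hm 0)
  set u : ℝ → ℝ → ℝ := fun t x => U₀ (ψ t x) with hu
  have hCD : ContDiff ℝ 1 fun q : ℝ × ℝ => u q.1 q.2 :=
    (contDiff_one_of_hasDerivAt hU cU).comp hφψ.contDiff_inv
  obtain ⟨u₁, u₂, h₁, h₂, c₁, c₂, hF⟩ := exists_partials hCD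
  have cu := hCD.continuous
  have cut : ∀ t, Continuous (u t) := fun t =>
    cu.comp (by fun_prop : Continuous fun x : ℝ => (t, x))
  -- The density is constant along the trajectory through `(t, x)`; its derivative there is the
  -- left-hand side.
  have htrans : ∀ t x, u₁ t x + b t x * u₂ t x = 0 := by
    intro t x
    have hd : HasDerivAt (fun s => (s, φ s (ψ t x))) ((1 : ℝ), b t (φ t (ψ t x))) t :=
      (hasDerivAt_id t).prodMk (hφψ.time t (ψ t x))
    have hc := (hF t (φ t (ψ t x))).comp_hasDerivAt t hd
    have hconst : ((fun q : ℝ × ℝ => u q.1 q.2) ∘ fun s => (s, φ s (ψ t x))) =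
        fun _ => U₀ (ψ t x) := by
      funext s
      simp [hu, hφψ.left_inv]
    rw [hconst] at hc
    have := hc.unique (hasDerivAt_const t _)
    simpa [hφψ.right_inv] using this
  set G : ℝ → ℝ := fun t => sSup ((fun x => |filterDer α L (u t) x|) '' Icc 0 L) with hG
  have cfd : Continuous fun q : ℝ × ℝ => filterDer α L (u q.1) q.2 := continuous_filterDer α L cu
  have cG : Continuous G := isCompact_Icc.continuous_sSup
    (f := fun t x => |filterDer α L (u t) x|) cfd.abs
  have hGle : ∀ t, ∀ x ∈ Icc 0 L, |filterDer α L (u t) x| ≤ G t := fun t x hx =>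
    le_csSup (isCompact_Icc.bddAbove_image
      (cfd.abs.comp (by fun_prop : Continuous fun x : ℝ => (t, x))).continuousOn)
      (mem_image_of_mem _ hx)
  -- Trajectories leave `[0, L]`, so the bound is needed on the whole line; the sine extension does
  -- not enlarge the supremum of the derivative.
  have hbxG : ∀ t ∈ Icc 0 T, ∀ x, |bx t x| ≤ G t := fun t ht x => by
    rw [(hfield t ht x).2]
    exact abs_sinExtDer_le hL.le (hGle t) x
  have hu₂exp : ∀ t ∈ Icc 0 T, ∀ x, |u₂ t x| ≤ m * Real.exp (∫ s in (0 : ℝ)..t, G s) := by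
    intro t ht x
    set ξ := ψ t x with hξ
    have hx : φ t ξ = x := hφψ.right_inv t x
    set I := ∫ s in (0 : ℝ)..t, bx s (φ s ξ) with hI
    have hc : HasDerivAt (u t ∘ φ t) (u₂ t (φ t ξ) * Real.exp I) ξ :=
      (h₂ t (φ t ξ)).comp ξ (hφψ.space t ξ)
    have hcomp : u t ∘ φ t = U₀ := by
      funext η
      simp [hu, hφψ.left_inv]
    rw [hcomp, hx] at hc
    have e1 : u₂ t x * Real.exp I = U₀' ξ := hc.unique (hU ξ)
    have e2 : u₂ t x = U₀' ξ * Real.exp (-I) := by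
      rw [← e1, mul_assoc, ← Real.exp_add]; simp
    have cb : Continuous fun s => bx s (φ s ξ) := cbx.comp (continuous_id.prodMk
      (hφψ.continuous_flow.comp (by fun_prop : Continuous fun s : ℝ => (s, ξ))))
    have e3 : -I ≤ ∫ s in (0 : ℝ)..t, G s := by
      rw [hI, ← intervalIntegral.integral_neg]
      refine intervalIntegral.integral_mono_on ht.1 (cb.neg.intervalIntegrable _ _)
        (cG.intervalIntegrable _ _) fun s hs => ?_
      have := (abs_le.1 (hbxG s ⟨hs.1, hs.2.trans ht.2⟩ (φ s ξ))).1
      linarith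
    rw [e2, abs_mul, Real.abs_exp]
    exact mul_le_mul (hm ξ) (Real.exp_le_exp.2 e3) (Real.exp_pos _).le hm0
  -- The maximum principle closes the loop: `G` is controlled by `sup |u_x|`, which is controlled by
  -- the integral of `G`.
  have hGexp : ∀ t ∈ Icc 0 T, G t ≤ m * Real.exp (∫ s in (0 : ℝ)..t, G s) := fun t ht =>
    csSup_le ((nonempty_Icc.2 hL.le).image _) (by
      rintro _ ⟨x, hx, rfl⟩
      exact abs_filterDer_le hα hL (h₂ t) (fun x _ => hu₂exp t ht x) x hx)
  -- With `E = exp (-∫ G)` the inequality `G ≤ m / E` reads `E' = -G E ≥ -m`. As `m T ≤ 1 / 2`, `E`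
  -- stays above `1 / 2`.
  have hE : ∀ t ∈ Icc 0 T, 1 - m * t ≤ Real.exp (-∫ s in (0 : ℝ)..t, G s) := by
    have dE : ∀ t, HasDerivAt (fun t => Real.exp (-∫ s in (0 : ℝ)..t, G s))
        (Real.exp (-∫ s in (0 : ℝ)..t, G s) * -G t) t := fun t =>
      (cG.integral_hasStrictDerivAt 0 t).hasDerivAt.neg.exp
    have df : ∀ t, HasDerivAt (fun t => 1 - m * t) (-m) t := fun t => by
      simpa using ((hasDerivAt_id t).const_mul m).const_sub 1
    intro t ht
    refine image_le_of_deriv_right_le_deriv_boundary (a := 0) (b := T) (f := fun t => 1 - m * t)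
      (fun s _ => (df s).continuousAt.continuousWithinAt) (fun s _ => (df s).hasDerivWithinAt)
      (by simp) (fun s _ => (dE s).continuousAt.continuousWithinAt)
      (fun s _ => (dE s).hasDerivWithinAt) (fun s hs => ?_) ht
    have h := mul_le_mul_of_nonneg_left (hGexp s ⟨hs.1, hs.2.le⟩)
      (Real.exp_pos (-∫ s in (0 : ℝ)..s, G s)).le
    rw [mul_left_comm, ← Real.exp_add, neg_add_cancel, Real.exp_zero, mul_one] at h
    linarith
  have hexp2 : ∀ t ∈ Icc 0 T, Real.exp (∫ s in (0 : ℝ)..t, G s) ≤ 2 := fun t ht => by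
    have h := hE t ht
    have h' : m * t ≤ 1 / 2 := (mul_le_mul_of_nonneg_left ht.2 hm0).trans hmT
    have hp := Real.exp_pos (∫ s in (0 : ℝ)..t, G s)
    have hone : Real.exp (-∫ s in (0 : ℝ)..t, G s) * Real.exp (∫ s in (0 : ℝ)..t, G s) = 1 := by
      rw [← Real.exp_add]; simp
    nlinarith
  have hu₂ : ∀ t ∈ Icc 0 T, ∀ x, |u₂ t x| ≤ 2 * m := fun t ht x => by
    have := mul_le_mul_of_nonneg_left (hexp2 t ht) hm0
    linarith [hu₂exp t ht x]
  have hfd : ∀ t ∈ Icc 0 T, ∀ x ∈ Icc 0 L, |filterDer α L (u t) x| ≤ 2 * m := fun t ht =>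
    abs_filterDer_le hα hL (h₂ t) fun x _ => hu₂ t ht x
  have hfs : ∀ t ∈ Icc 0 T, ∀ x ∈ Icc 0 L, |filterSol α L (u t) x| ≤ A + 2 * m * L := by
    intro t ht x hx
    have h := Convex.norm_image_sub_le_of_norm_hasDerivWithin_le (C := 2 * m)
      (fun s (_ : s ∈ Icc 0 L) => (hasDerivAt_filterSol α L (cut t) s).hasDerivWithinAt)
      (fun s hs => hfd t ht s hs) (convex_Icc 0 L) ⟨le_rfl, hL.le⟩ hx
    rw [filterSol_zero, Real.norm_eq_abs, Real.norm_eq_abs, sub_zero, abs_of_nonneg hx.1] at h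
    have h2 : |filterSol α L (u t) x| ≤ |u t 0| + |filterSol α L (u t) x - u t 0| := by
      have := abs_add_le (u t 0) (filterSol α L (u t) x - u t 0)
      simpa using this
    have h3 : |u t 0| ≤ A := hA _
    have h4 := mul_le_mul_of_nonneg_left hx.2 (by linarith : 0 ≤ 2 * m)
    linarith
  refine ⟨u, u₁, u₂, hCD, h₁, h₂, fun t ht x hx => ?_, fun t x => hA _, hu₂, fun x => ?_,
    fun x hx => ?_⟩
  · have hv : velocity α L (u t) x = filterSol α L (u t) x := sinExt_of_mem hx
    rw [← hv, ← (hfield t ht x).1]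
    exact htrans t x
  · have := hφψ.left_inv 0 x
    rw [hφψ.zero] at this
    simp only [hu, this]
  · refine hsupp _ ?_
    set ξ := ψ T x with hξ
    have hx' : φ T ξ = x := hφψ.right_inv T x
    have hd : ∀ s, HasDerivAt (fun s => φ s ξ - P s) (b s (φ s ξ) - ℓ s) s := fun s =>
      (hφψ.time s ξ).sub (hP s)
    -- A particle deviates from the drift `P` at speed at most `sup |w| + sup |w'|`, the second term
    -- coming from the sine extension. With `hexit`, arrival at `x ≤ L` forces a start at `ξ ≤ -1`.
    have h := Convex.norm_image_sub_le_of_norm_hasDerivWithin_le (C := A + 2 * m * L + 2 * m)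
      (fun s (_ : s ∈ Icc 0 T) => (hd s).hasDerivWithinAt)
      (fun s hs => by
        rw [(hfield s hs _).1, add_sub_cancel_left]
        exact abs_sinExt_le hL.le (hfs s hs) (hfd s hs) _)
      (convex_Icc 0 T) ⟨le_rfl, hT⟩ ⟨hT, le_rfl⟩
    rw [hφψ.zero, hx', Real.norm_eq_abs, Real.norm_eq_abs, sub_zero, abs_of_nonneg hT] at h
    linarith [(abs_le.1 h).1]

end Density

/-! ### Norms of the controls -/

section Norms

variable {E : Type*} [NormedAddCommGroup E] {K : Set ℝ} {f : ℝ → E} {C : ℝ}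

theorem c0Norm_le (hK : K.Nonempty) (h : ∀ s ∈ K, ‖f s‖ ≤ C) : c0Norm K f ≤ C :=
  csSup_le (hK.image _) (by rintro _ ⟨s, hs, rfl⟩; exact h s hs)

theorem norm_le_c0Norm (hK : IsCompact K) (hf : ContinuousOn f K) {s : ℝ} (hs : s ∈ K) :
    ‖f s‖ ≤ c0Norm K f :=
  le_csSup (hK.bddAbove_image hf.norm) (mem_image_of_mem _ hs)

theorem c0Norm_nonneg (K : Set ℝ) (f : ℝ → E) : 0 ≤ c0Norm K f :=
  Real.sSup_nonneg (by rintro _ ⟨s, -, rfl⟩; exact norm_nonneg _)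

theorem norm_pair_le (a b : ℝ) : ‖!₂[a, b]‖ ≤ |a| + |b| := by
  rw [EuclideanSpace.norm_eq, Fin.sum_univ_two]
  refine Real.sqrt_le_iff.2 ⟨by positivity, ?_⟩
  simp only [Real.norm_eq_abs, Matrix.cons_val_zero, Matrix.cons_val_one]
  nlinarith [mul_nonneg (abs_nonneg a) (abs_nonneg b)]

theorem hasDerivWithinAt_pair {f g : ℝ → ℝ} {f' g' : ℝ} {s : Set ℝ} {t : ℝ}
    (hf : HasDerivWithinAt f f' s t) (hg : HasDerivWithinAt g g' s t) :
    HasDerivWithinAt (fun t => !₂[f t, g t]) !₂[f', g'] s t := by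
  refine hasFDerivWithinAt_euclidean.2 fun i => ?_
  fin_cases i
  · refine hf.hasFDerivWithinAt.congr_fderiv ?_
    ext; simp
  · refine hg.hasFDerivWithinAt.congr_fderiv ?_
    ext; simp

theorem c1Norm_pair_le {a b : ℝ} (hab : a < b) {f g f' g' : ℝ → ℝ}
    (hf : ∀ t, HasDerivAt f (f' t) t) (hg : ∀ t, HasDerivAt g (g' t) t) {M M' : ℝ}
    (hM : ∀ t ∈ Icc a b, |f t| ≤ M ∧ |g t| ≤ M)
    (hM' : ∀ t ∈ Icc a b, |f' t| ≤ M' ∧ |g' t| ≤ M') :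
    c1Norm (Icc a b) (fun t => !₂[f t, g t]) ≤ 2 * M + 2 * M' := by
  have hne : (Icc a b).Nonempty := nonempty_Icc.2 hab.le
  refine add_le_add (c0Norm_le hne fun t ht => ?_) (c0Norm_le hne fun t ht => ?_)
  · linarith [norm_pair_le (f t) (g t), hM t ht]
  · rw [(hasDerivWithinAt_pair (hf t).hasDerivWithinAt (hg t).hasDerivWithinAt).derivWithin
      (uniqueDiffOn_Icc hab t ht)]
    linarith [norm_pair_le (f' t) (g' t), hM' t ht]

end Norms

/-! ### Extension of the initial datum -/

section InitialDatum

/-- A smooth cutoff vanishing on `(-∞, -1]` and equal to `1` on `[0, ∞)`. -/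
theorem exists_cutoff : ∃ (χ χ' : ℝ → ℝ) (M : ℝ), 0 ≤ M ∧ (∀ x, HasDerivAt χ (χ' x) x) ∧
    Continuous χ' ∧ (∀ x, |χ x| ≤ 1) ∧ (∀ x, |χ' x| ≤ M) ∧ (∀ x ≤ -1, χ x = 0) ∧
    ∀ x, 0 ≤ x → χ x = 1 := by
  set χ : ℝ → ℝ := fun x => Real.smoothTransition (x + 1) with hχ
  have hC : ContDiff ℝ 1 χ := Real.smoothTransition.contDiff.comp (contDiff_id.add contDiff_const)
  have hc : Continuous (deriv χ) := hC.continuous_deriv le_rfl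
  obtain ⟨M, hM⟩ := (isCompact_Icc (a := (-1 : ℝ)) (b := 0)).exists_bound_of_continuousOn
    hc.continuousOn
  have hM0 : 0 ≤ M := (norm_nonneg _).trans (hM 0 ⟨by norm_num, le_rfl⟩)
  refine ⟨χ, deriv χ, M, hM0, fun x => (hC.differentiable one_ne_zero x).hasDerivAt, hc,
    fun x => ?_, fun x => ?_, fun x hx => Real.smoothTransition.zero_of_nonpos (by linarith),
    fun x hx => Real.smoothTransition.one_of_one_le (by linarith)⟩
  · rw [abs_of_nonneg (Real.smoothTransition.nonneg _)]
    exact Real.smoothTransition.le_one _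
  · rcases lt_or_ge x (-1) with h | h
    · have : χ =ᶠ[𝓝 x] fun _ => 0 := by
        filter_upwards [Iio_mem_nhds h] with y hy
        exact Real.smoothTransition.zero_of_nonpos (by linarith [mem_Iio.1 hy])
      rwa [this.deriv_eq, deriv_const, abs_zero]
    rcases lt_or_ge 0 x with h' | h'
    · have : χ =ᶠ[𝓝 x] fun _ => 1 := by
        filter_upwards [Ioi_mem_nhds h'] with y hy
        exact Real.smoothTransition.one_of_one_le (by linarith [mem_Ioi.1 hy])
      rwa [this.deriv_eq, deriv_const, abs_zero]
    · exact hM x ⟨h, h'⟩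

/-- Extension of a `C¹` function on `[0, L]` to a `C¹` function on `ℝ` vanishing on `(-∞, -1]`. -/
theorem exists_extension : ∃ κ : ℝ, 0 < κ ∧ ∀ (L δ : ℝ) (y₀ : ℝ → ℝ), 0 < L →
    ContDiffOn ℝ 1 y₀ (Icc 0 L) → c1Norm (Icc 0 L) y₀ ≤ δ →
    ∃ U₀ U₀' : ℝ → ℝ, (∀ x, HasDerivAt U₀ (U₀' x) x) ∧ Continuous U₀' ∧
      (∀ x, |U₀ x| ≤ κ * δ) ∧ (∀ x, |U₀' x| ≤ κ * δ) ∧ (∀ x ≤ -1, U₀ x = 0) ∧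
      ∀ x ∈ Icc 0 L, U₀ x = y₀ x := by
  obtain ⟨χ, χ', M, hM0, hχ, cχ', bχ, bχ', zχ, oχ⟩ := exists_cutoff
  -- The sine extension is bounded by `2 δ` with derivative bounded by `δ`, so the product with the
  -- cutoff has derivative at most `2 M δ + δ`. No cutoff is needed on the right, because the flow
  -- moves that part away from `[0, L]`.
  refine ⟨2 * M + 2, by positivity, fun L δ y₀ hL hy hδ => ?_⟩
  have hun := uniqueDiffOn_Icc hL
  have cy' : ContinuousOn (derivWithin y₀ (Icc 0 L)) (Icc 0 L) :=
    hy.continuousOn_derivWithin hun le_rfl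
  have n0 := c0Norm_nonneg (Icc 0 L) y₀
  have n1 := c0Norm_nonneg (Icc 0 L) (derivWithin y₀ (Icc 0 L))
  unfold c1Norm at hδ
  have b0 : ∀ x ∈ Icc 0 L, |y₀ x| ≤ δ := fun x hx =>
    (norm_le_c0Norm isCompact_Icc hy.continuousOn hx).trans (by linarith)
  have b1 : ∀ x ∈ Icc 0 L, |derivWithin y₀ (Icc 0 L) x| ≤ δ := fun x hx =>
    (norm_le_c0Norm isCompact_Icc cy' hx).trans (by linarith)
  set F := sinExt L y₀ (derivWithin y₀ (Icc 0 L)) with hF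
  set F' := sinExtDer L (derivWithin y₀ (Icc 0 L)) with hF'
  have dF : ∀ x, HasDerivAt F (F' x) x := hasDerivAt_sinExt hL.le fun x hx =>
    (hy.differentiableOn one_ne_zero x hx).hasDerivWithinAt
  have cF : Continuous F := continuous_iff_continuousAt.2 fun x => (dF x).continuousAt
  have cχ : Continuous χ := continuous_iff_continuousAt.2 fun x => (hχ x).continuousAt
  have cF' : Continuous F' := by
    have h := cy'.comp_continuous (continuous_clamp 0 L) (clamp_mem hL.le)
    exact h.mul (Real.continuous_cos.comp (continuous_id.sub (continuous_clamp 0 L)))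
  have bF : ∀ x, |F x| ≤ δ + δ := abs_sinExt_le hL.le b0 b1
  have bF' : ∀ x, |F' x| ≤ δ := abs_sinExtDer_le hL.le b1
  have hδ0 : 0 ≤ δ := by linarith
  refine ⟨fun x => χ x * F x, fun x => χ' x * F x + χ x * F' x, fun x => (hχ x).mul (dF x),
    (cχ'.mul cF).add (cχ.mul cF'), fun x => ?_, fun x => ?_, fun x hx => by simp [zχ x hx],
    fun x hx => by simp only [oχ x hx.1, one_mul]; exact sinExt_of_mem hx⟩
  · rw [abs_mul]
    have h := mul_le_mul (bχ x) (bF x) (abs_nonneg _) zero_le_one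
    nlinarith [mul_nonneg hM0 hδ0]
  · refine (abs_add_le _ _).trans ?_
    rw [abs_mul, abs_mul]
    have h1 := mul_le_mul (bχ' x) (bF x) (abs_nonneg _) hM0
    have h2 := mul_le_mul (bχ x) (bF' x) (abs_nonneg _) zero_le_one
    linarith

end InitialDatum

end BurgersAlpha

/-! ### Choice of constants and of the return trajectory; conclusion -/

open BurgersAlpha in
theorem mainTheorem5 (T L : ℝ) (hT : 0 < T) (hL : 0 < L) :
    ∃ δ : ℝ, 0 < δ ∧ ∃ C : ℝ, 0 < C ∧
      ∀ α : ℝ, 0 < α →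
      ∀ y₀ : ℝ → ℝ, ContDiffOn ℝ 1 y₀ (Set.Icc 0 L) →
        BurgersAlpha.c1Norm (Set.Icc 0 L) y₀ ≤ δ →
        ∃ (p vl vr : ℝ → ℝ) (y z : ℝ → ℝ → ℝ),
          ContinuousOn p (Set.Icc 0 T) ∧ p T = 0 ∧
          ContDiffOn ℝ 1 vl (Set.Icc 0 T) ∧ ContDiffOn ℝ 1 vr (Set.Icc 0 T) ∧
          BurgersAlpha.IsSolution T L α y₀ p vl vr y z ∧
          (∀ x ∈ Set.Ioo 0 L, y T x = 0 ∧ z T x = 0) ∧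
          BurgersAlpha.c0Norm (Set.Icc 0 T) p +
            BurgersAlpha.c1Norm (Set.Icc 0 T) (fun t => !₂[vl t, vr t]) ≤ C := by
  obtain ⟨κ, hκ, hext⟩ := exists_extension
  -- Small enough that `m T ≤ 1 / 2`, `2 m ≤ 1`, and the deviation speed `m + 2 m L + 2 m` is at
  -- most `1`.
  set m : ℝ := 1 / (2 * T + 2 * L + 3) with hm
  have hm0 : 0 < m := by positivity
  have hmeq : m * (2 * T + 2 * L + 3) = 1 := by rw [hm]; field_simp
  have hmT0 : 0 < m * T := by positivity
  have hmL0 : 0 < m * L := by positivity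
  -- the return trajectory `ℓ` and its primitive
  set Λ : ℝ := 12 * (L + 1 + T) / T ^ 4 with hΛ
  -- This is `Λ t (T - t)²`; the double zero at `T` gives `p T = 0`. As `∫₀ᵀ t (T - t)² = T⁴ / 12`,
  -- the factor `Λ` makes the displacement `L + 1 + T`: `L + 1` to carry `-1` to `L`, and `T` to
  -- absorb a deviation at speed at most `1`.
  set ℓ : ℝ → ℝ := fun t => Λ * (T ^ 2 * t - 2 * T * t ^ 2 + t ^ 3) with hℓ
  set ℓ' : ℝ → ℝ := fun t => Λ * (T ^ 2 - 2 * T * (2 * t) + 3 * t ^ 2) with hℓ'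
  set P : ℝ → ℝ := fun t => Λ * (T ^ 2 * t ^ 2 / 2 - 2 * T * t ^ 3 / 3 + t ^ 4 / 4) with hP
  have dpow : ∀ (n : ℕ) (t : ℝ), HasDerivAt (fun t : ℝ => t ^ n) (n * t ^ (n - 1)) t :=
    fun n t => hasDerivAt_pow n t
  have dℓ : ∀ t, HasDerivAt ℓ (ℓ' t) t := fun t => by
    have := (((((hasDerivAt_id t).const_mul (T ^ 2)).sub ((dpow 2 t).const_mul (2 * T))).add
      (dpow 3 t)).const_mul Λ)
    refine this.congr_deriv ?_
    simp only [hℓ']; norm_num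
  have dP : ∀ t, HasDerivAt P (ℓ t) t := fun t => by
    have := (((((dpow 2 t).const_mul (T ^ 2)).div_const 2).sub
      (((dpow 3 t).const_mul (2 * T)).div_const 3)).add ((dpow 4 t).div_const 4)).const_mul Λ
    refine this.congr_deriv ?_
    simp only [hℓ]; norm_num; left; ring
  have cℓ' : Continuous ℓ' := by fun_prop
  have cℓ : Continuous ℓ := by fun_prop
  have hℓ0 : ℓ 0 = 0 := by simp [hℓ]
  have hℓT : ℓ T = 0 := by simp only [hℓ]; ring
  have hℓ'T : ℓ' T = 0 := by simp only [hℓ']; ring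
  have hPT : P T - P 0 = L + 1 + T := by
    simp only [hP, hΛ]; field_simp; ring
  obtain ⟨M₀, hM₀⟩ := (isCompact_Icc (a := 0) (b := T)).exists_bound_of_continuousOn cℓ.continuousOn
  obtain ⟨M₁, hM₁⟩ := (isCompact_Icc (a := 0) (b := T)).exists_bound_of_continuousOn
    cℓ'.continuousOn
  have hT0 : (0 : ℝ) ∈ Icc 0 T := ⟨le_rfl, hT.le⟩
  have hM₀0 : 0 ≤ M₀ := (norm_nonneg _).trans (hM₀ 0 hT0)
  have hM₁0 : 0 ≤ M₁ := (norm_nonneg _).trans (hM₁ 0 hT0)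
  refine ⟨m / κ, by positivity, M₁ + (2 * (M₀ + 1) + 2 * (M₁ + (M₀ + 1))), by positivity,
    fun α hα y₀ hy₀ hδ => ?_⟩
  obtain ⟨U₀, U₀', hU, cU, hA, hm', hsupp, hU₀⟩ := hext L _ y₀ hL hy₀ hδ
  rw [mul_div_cancel₀ m hκ.ne'] at hA hm'
  obtain ⟨u, u₁, u₂, hCD, h₁, h₂, htr, bu, bu₂, hu0, huT⟩ :=
    exists_transported_density hT.le hL hα cℓ dP hU cU hA hm' hsupp (by linarith) (by
      rw [hPT]
      have : (m + 2 * m * L + 2 * m) * T ≤ 1 * T :=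
        mul_le_mul_of_nonneg_right (by linarith) hT.le
      linarith)
  have cu := hCD.continuous
  have cut : ∀ t, Continuous (u t) := fun t =>
    cu.comp (by fun_prop : Continuous fun x : ℝ => (t, x))
  have hm1 : m ≤ 1 / 2 := by linarith
  have Cℓ : ContDiff ℝ 1 ℓ := contDiff_one_of_hasDerivAt dℓ cℓ'
  have Cu : ∀ x, ContDiff ℝ 1 fun t => u t x := fun x =>
    hCD.comp (contDiff_id.prodMk contDiff_const)
  have h0 : (0 : ℝ) ∈ Icc 0 L := ⟨le_rfl, hL.le⟩
  have hLL : L ∈ Icc 0 L := ⟨hL.le, le_rfl⟩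
  have dv : ∀ x t, HasDerivAt (fun t => ℓ t + u t x) (ℓ' t + u₁ t x) t := fun x t =>
    (dℓ t).add (h₁ t x)
  have bv : ∀ x, ∀ t ∈ Icc 0 T, |ℓ t + u t x| ≤ M₀ + 1 := fun x t ht =>
    (abs_add_le _ _).trans (add_le_add (hM₀ t ht) ((bu t x).trans (by linarith)))
  -- At the end points `w = u`, so the transport equation expresses `u_t` through `ℓ + u` and `u_x`,
  -- both bounded independently of `α`.
  have bd : ∀ x ∈ Icc 0 L, ∀ t ∈ Icc 0 T, filterSol α L (u t) x = u t x →
      |ℓ' t + u₁ t x| ≤ M₁ + (M₀ + 1) := by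
    intro x hx t ht hw
    refine (abs_add_le _ _).trans (add_le_add (hM₁ t ht) ?_)
    have e := htr t ht x hx
    rw [hw] at e
    have e' : u₁ t x = -((ℓ t + u t x) * u₂ t x) := by linarith
    rw [e', abs_neg, abs_mul]
    have := mul_le_mul (bv x t ht) ((bu₂ t ht x).trans (by linarith : 2 * m ≤ 1))
      (abs_nonneg _) (by positivity)
    linarith
  refine ⟨ℓ', fun t => ℓ t + u t 0, fun t => ℓ t + u t L, fun t x => ℓ t + u t x,
    fun t x => ℓ t + filterSol α L (u t) x, cℓ'.continuousOn, hℓ'T, (Cℓ.add (Cu 0)).contDiffOn,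
    (Cℓ.add (Cu L)).contDiffOn, ?_, fun x hx => ?_, ?_⟩
  · refine
      { contDiffOn_y := ((Cℓ.comp contDiff_fst).add hCD).contDiffOn
        contDiffOn_z := ((Cℓ.comp contDiff_fst).add (contDiff_filterSol α L hCD)).contDiffOn
        transport := fun t ht x hx => ?_
        contDiffOn_z_space := fun t _ =>
          (contDiff_const.add (contDiff_two_filterSol hα.ne' (cut t))).contDiffOn
        filter := fun t _ x _ => ?_
        left := fun t _ => ⟨by simp only [filterSol_zero], rfl⟩
        right := fun t _ => ⟨by simp only [filterSol_right hα hL], rfl⟩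
        initial := fun x hx => ?_ }
    · rw [(dv x t).deriv, ((h₂ t x).const_add (ℓ t)).deriv]
      linarith [htr t (Ioo_subset_Icc_self ht) x (Ioo_subset_Icc_self hx)]
    · have e : deriv (fun x => ℓ t + filterSol α L (u t) x) = filterDer α L (u t) :=
        funext fun x => ((hasDerivAt_filterSol α L (cut t) x).const_add (ℓ t)).deriv
      rw [e, (hasDerivAt_filterDer hα.ne' L (cut t) x).deriv]
      field_simp
      ring
    · simp only [hℓ0, zero_add, hu0]
      exact hU₀ x (Ioo_subset_Icc_self hx)
  · have e : filterSol α L (u T) x = 0 := by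
      rw [filterSol_congr α hL.le (v := fun _ => 0) (fun s hs => huT s hs.2)
        (Ioo_subset_Icc_self hx), filterSol_const_zero]
    simp only [hℓT, huT x hx.2.le, e, add_zero, and_self]
  · refine add_le_add (c0Norm_le ⟨0, hT0⟩ hM₁)
      (c1Norm_pair_le hT (dv 0) (dv L) (fun t ht => ⟨bv 0 t ht, bv L t ht⟩)
        fun t ht => ⟨?_, ?_⟩)
    · exact bd 0 h0 t ht (filterSol_zero α L _)
    · exact bd L hLL t ht (filterSol_right hα hL _)
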